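/- For $m\ge 1$ let $h_m=\sum_{i=1}^m \frac1i$. For $m\ge 2$ let $q(m,i)=\frac{m}{2h_{m-1}}\cdot\frac{1}{i(m-i)}$, $1\le i\le m-1$, which is a probability distribution on $\{1,\dots,m-1\}$. For $n\ge 1$, the critical beta-splitting random tree on $n$ leaves is the random binary tree constructed by recursively splitting the integer interval $\{1,\dots,n\}$: an interval with $m\ge 2$ elements is split, after an exponentially distributed holding time with rate $h_{m-1}$, into a left subinterval with $i$ elements and a right subinterval with $m-i$ elements with probability $q(m,i)$, all splits and holding times being independent; intervals of size $1$ are the leaves. The time-height of a leaf is the sum of the holding times, and its edge-height the number of splits, along the path from the root to that leaf. Let $D_n$ and $L_n$ be the time-height and the edge-height of a leaf chosen uniformly at random, independently of the tree, among the $n$ leaves. Let $\zeta(r)=\sum_{j\ge 1}j^{-r}$ for $r>1$. **Theorem 1.7.** As $n\to\infty$, each of the two random variables $$X_n=\frac{D_n-\zeta(2)^{-1}\log n}{\sqrt{\frac{2\zeta(3)}{\zeta(2)^3}\log n}},\qquad Y_n=\frac{L_n-(2\zeta(2))^{-1}\log^2 n}{\sqrt{\frac{2\zeta(3)}{3\zeta(2)^3}\log^3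 n}}\qquad(n\ge 2)$$ converges in distribution to the standard normal distribution $\mathrm{Normal}(0,1)$. Moreover all moments converge: for every integer $k\ge 0$, $X_n^k$ and $Y_n^k$ are integrable for all $n\ge 2$, and $\mathbb E[X_n^k]\to\mathbb E[Z^k]$ and $\mathbb E[Y_n^k]\to\mathbb E[Z^k]$ as $n\to\infty$, where $Z\sim\mathrm{Normal}(0,1)$. -/

import Mathlib

open MeasureTheory ProbabilityTheory Filter Topology

namespace BetaSplit

/-- The real value `ζ(s)` of the Riemann zeta function at a natural number `s ≥ 2`. -/
noncomputable def zetaReal (s : ℕ) : ℝ := (riemannZeta (s : ℂ)).re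

/-- The harmonic sum `h_m = 1 + 1/2 + ... + 1/m`, as a real number. -/
noncomputable def h (m : ℕ) : ℝ := ((harmonic m : ℚ) : ℝ)

/-- The splitting probability `q(m, i) = m / (2 h_{m-1}) * 1 / (i (m - i))`: the probability, for
`m ≥ 2` and `1 ≤ i ≤ m - 1`, that `m` leaves are split into `i` left and `m - i` right leaves. -/
noncomputable def q (m i : ℕ) : ℝ :=
  (m : ℝ) / (2 * h (m - 1)) * (1 / ((i : ℝ) * ((m : ℝ) - (i : ℝ))))

theorem h_eq_sum (m : ℕ) : h m = ∑ i ∈ Finset.range m, 1 / ((i : ℝ) + 1) := by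
  simp [h, harmonic]

theorem h_succ_pos (k : ℕ) : 0 < h (k + 1) := by
  rw [h_eq_sum]
  exact Finset.sum_pos (fun i _ => by positivity) ⟨0, by simp⟩

theorem q_nonneg (k : ℕ) (i : Fin (k + 1)) : 0 ≤ q (k + 2) (i + 1) := by
  have h1 : (i : ℝ) ≤ k := by exact_mod_cast Nat.lt_succ_iff.mp i.isLt
  have h2 : 0 < h (k + 1) := h_succ_pos k
  have h3 : (0 : ℝ) ≤ ((k + 2 : ℕ) : ℝ) - ((i + 1 : ℕ) : ℝ) := by push_cast; linarith
  unfold q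
  simp only [show k + 2 - 1 = k + 1 from rfl]
  positivity

theorem sum_q (k : ℕ) : ∑ i : Fin (k + 1), q (k + 2) (i + 1) = 1 := by
  have hp : 0 < h (k + 1) := h_succ_pos k
  have hk : (0 : ℝ) < (k : ℝ) + 2 := by positivity
  rw [Fin.sum_univ_eq_sum_range (fun i => q (k + 2) (i + 1)) (k + 1)]
  have e : ∀ i ∈ Finset.range (k + 1), q (k + 2) (i + 1) =
      1 / (2 * h (k + 1)) * (1 / ((i : ℝ) + 1) + 1 / (((k + 1 - 1 - i : ℕ) : ℝ) + 1)) := by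
    intro i hi
    have hi' : i ≤ k := Nat.lt_succ_iff.mp (Finset.mem_range.mp hi)
    have hir : (i : ℝ) ≤ k := by exact_mod_cast hi'
    have h1 : (k : ℝ) - i + 1 ≠ 0 := by linarith
    have h2 : (k : ℝ) + 2 - (i + 1) ≠ 0 := by linarith
    have h3 : (i : ℝ) + 1 ≠ 0 := by positivity
    simp only [q, Nat.add_sub_cancel, show k + 2 - 1 = k + 1 from rfl]
    push_cast [Nat.cast_sub hi']
    field_simp
    ring
  rw [Finset.sum_congr rfl e, ← Finset.mul_sum, Finset.sum_add_distrib,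
    Finset.sum_range_reflect (fun i => 1 / ((i : ℝ) + 1)) (k + 1), ← h_eq_sum]
  field_simp
  ring

/-- The law of the split of an interval with `k + 2` leaves; the value `i : Fin (k + 1)` means that
the left part has `i + 1` leaves (and the right part the remaining `k + 1 - i` leaves). -/
noncomputable def splitPMF (k : ℕ) : PMF (Fin (k + 1)) :=
  PMF.ofFintype (fun i => ENNReal.ofReal (q (k + 2) (i + 1))) (by
    rw [← ENNReal.ofReal_sum_of_nonneg (fun i _ => q_nonneg k i), sum_q, ENNReal.ofReal_one])

/-- The randomness attached to an interval with `k + 2` leaves: a split with law `q (k + 2)` and,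
independently, an exponential holding time with rate `h_{k+1}`. -/
noncomputable def nodeMeasure (k : ℕ) : Measure (Fin (k + 1) × ℝ) :=
  (splitPMF k).toMeasure.prod (expMeasure (h (k + 1)))

instance (k : ℕ) : IsProbabilityMeasure (nodeMeasure k) := by
  have := isProbabilityMeasure_expMeasure (h_succ_pos k)
  unfold nodeMeasure
  infer_instance

/-- A choice of a split and of a holding time for every integer interval with at least two elements;
the index `(a, k)` stands for the interval `{a, a + 1, ..., a + k + 1}`, which has `k + 2`
elements. -/
abbrev Config : Type := (p : ℕ × ℕ) → Fin (p.2 + 1) × ℝ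

/-- Splits and holding times are independent over all intervals. (In one recursive splitting, an
interval appears at most once, so that every split and holding time used is a fresh one.) -/
noncomputable def configMeasure : Measure Config :=
  Measure.infinitePi (fun p : ℕ × ℕ => nodeMeasure p.2)

instance : IsProbabilityMeasure configMeasure := by
  unfold configMeasure
  infer_instance

/-- Finite binary trees whose branchpoints carry a holding time. -/
inductive SplitTree : Type
  | leaf : SplitTree
  | node (holdingTime : ℝ) (left right : SplitTree) : SplitTree

namespace SplitTree

/-- The number of leaves. -/
def numLeaves : SplitTree → ℕ
  | leaf => 1
  | node _ l r => l.numLeaves + r.numLeaves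

/-- The time-height of the leaf number `x` (leaves are numbered `0, 1, 2, ...` from left to right):
the sum of the holding times at the branchpoints on the path from the root to that leaf. -/
noncomputable def timeHeight : SplitTree → ℕ → ℝ
  | leaf, _ => 0
  | node t l r, x =>
      t + if x < l.numLeaves then l.timeHeight x else r.timeHeight (x - l.numLeaves)

/-- The edge-height of the leaf number `x`: the number of edges on (equivalently, of splits along)
the path from the root to that leaf. -/
def edgeHeight : SplitTree → ℕ → ℕ
  | leaf, _ => 0
  | node _ l r, x =>
      1 + if x < l.numLeaves then l.edgeHeight x else r.edgeHeight (x - l.numLeaves)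

end SplitTree

/-- The tree obtained by recursively splitting the interval `{a, ..., a + m - 1}` of `m ≥ 1` leaves
according to the configuration `ω`, until intervals of size `1` are reached. (The value for `m = 0`
is a convention; it is never used when one starts with `m ≥ 1`.) -/
def splitTree (ω : Config) : ℕ → ℕ → SplitTree
  | _, 0 => .leaf
  | _, 1 => .leaf
  | a, k + 2 =>
      .node (ω (a, k)).2
        (splitTree ω a ((ω (a, k)).1.val + 1))
        (splitTree ω (a + ((ω (a, k)).1.val + 1)) (k + 2 - ((ω (a, k)).1.val + 1)))
  termination_by _ m => m
  decreasing_by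
    all_goals
      have := (ω (a, k)).1.isLt
      omega

/-- The sample space for the critical beta-splitting random tree on `n` leaves together with a
marked leaf. -/
abbrev Sample (n : ℕ) : Type := Config × Fin n

/-- The marked leaf is uniform and independent of the tree. -/
noncomputable def sampleMeasure (n : ℕ) [NeZero n] : Measure (Sample n) :=
  configMeasure.prod (PMF.uniformOfFintype (Fin n)).toMeasure

instance (n : ℕ) [NeZero n] : IsProbabilityMeasure (sampleMeasure n) := by
  unfold sampleMeasure
  infer_instance

/-- `D_n`: the time-height of a uniform random leaf of the random tree on `n` leaves. -/
noncomputable def D (n : ℕ) (s : Sample n) : ℝ := (splitTree s.1 0 n).timeHeight s.2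

/-- `L_n`: the edge-height of a uniform random leaf of the random tree on `n` leaves. -/
def L (n : ℕ) (s : Sample n) : ℕ := (splitTree s.1 0 n).edgeHeight s.2

/-- `(D_n - log n / ζ(2)) / √(2 ζ(3) / ζ(2)³ * log n)`. -/
noncomputable def normalizedD (n : ℕ) (s : Sample n) : ℝ :=
  (D n s - Real.log n / zetaReal 2) /
    Real.sqrt (2 * zetaReal 3 / zetaReal 2 ^ 3 * Real.log n)

/-- `(L_n - log² n / (2 ζ(2))) / √(2 ζ(3) / (3 ζ(2)³) * log³ n)`. -/
noncomputable def normalizedL (n : ℕ) (s : Sample n) : ℝ :=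
  ((L n s : ℝ) - Real.log n ^ 2 / (2 * zetaReal 2)) /
    Real.sqrt (2 * zetaReal 3 / (3 * zetaReal 2 ^ 3) * Real.log n ^ 3)

end BetaSplit

/-! Following a uniform random leaf through the splits gives a Markov chain on sizes that jumps from
`m + 1` to `j + 1` at rate `1 / (m - j)`, `0 ≤ j < m`. Hence the joint exponential moment `ψ m` of the
two heights for `m + 1` leaves satisfies the recursion
`ψ m * (h m - c m) = ∑ j < m, ψ j / (m - j)`, where `c m = z` for the time-height with parameter `z`
and `c m = (1 - e^(-w)) h m` for the edge-height with parameter `w` (`expMoment`,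
`integrable_exp_D_L`). As the kernel is positive, any function with `≤` or `≥` in place of
equality bounds `ψ` from one side (`le_of_supersolution`, `le_of_subsolution`).

The products `P x m = ∏ k < m, (1 + x / (k + 1))` behave like `m ^ x`, and the kernel acts on them
exactly: `∑ j < m, P x j / (m - j) = P x m * ∑ k < m, 1 / (k + 1 + x)` (`sum_riseProd_div`). So the
generator multiplies `P x` by `-∑ k < m, x / ((k + 1) (k + 1 + x))`, which tends to
`-(ζ(2) x - ζ(3) x² + O(x³))`. For the time-height one takes `ζ(2) x - ζ(3) x² = z`, with a shift of
order `x³` in the exponent and a small multiple of `P (x - 1)` absorbing the errors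
(`exp_time_bounds`). For the edge-height `x` has to follow `ζ(2) x - ζ(3) x² = w h m`, and one uses
products with a slowly varying exponent; exponential moments of the jumps of `h` show that the
generator still acts on them as if the exponent were frozen
(`abs_sum_riseProd_ratio_add_eigen_le`, `exp_edge_bounds`).

With `z` of order `(log n)^(-1/2)`, respectively `w` of order `(log n)^(-3/2)`, these bounds show
that the Laplace transforms of the normalized heights converge to that of the normal law.
Convergence of all moments follows by comparing Taylor coefficients
(`TendstoLaplace.tendsto_moment`), and convergence of the characteristic functions from that of the
moments (`TendstoLaplace.tendsto_charFun`). -/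

namespace BetaSplit

/-! ### The recursion for the joint exponential moments -/

section Resampling

variable {ι : Type*} {X : ι → Type*} [DecidableEq ι] [∀ i, MeasurableSpace (X i)]

theorem measurable_update_prod (p : ι) :
    Measurable (fun z : ((i : ι) → X i) × X p => Function.update z.1 p z.2) := by
  rw [measurable_pi_iff]
  intro i
  by_cases hi : i = p
  · subst hi
    simpa using measurable_snd
  · simp only [Function.update_of_ne hi]
    fun_prop

/-- Resampling one coordinate of an infinite product measure does not change the law. -/
theorem map_update_infinitePi (μ : (i : ι) → Measure (X i)) [∀ i, IsProbabilityMeasure (μ i)]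
    (p : ι) :
    ((Measure.infinitePi μ).prod (μ p)).map (fun z => Function.update z.1 p z.2) =
      Measure.infinitePi μ := by
  refine Measure.eq_infinitePi μ fun s t ht => ?_
  rw [Measure.map_apply (measurable_update_prod p)
    (MeasurableSet.pi s.countable_toSet fun i _ => ht i)]
  by_cases hp : p ∈ s
  · have e : (fun z : ((i : ι) → X i) × X p => Function.update z.1 p z.2) ⁻¹'
        (Set.pi s t) = (Set.pi (s.erase p : Finset ι) t) ×ˢ (t p) := by
      ext z
      simp only [Set.mem_preimage, Set.mem_pi, Finset.mem_coe, Set.mem_prod, Finset.mem_erase]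
      constructor
      · intro H
        refine ⟨fun i hi => ?_, by simpa using H p hp⟩
        simpa [Function.update_of_ne hi.1] using H i hi.2
      · rintro ⟨H1, H2⟩ i hi
        by_cases hip : i = p
        · subst hip; simpa using H2
        · simpa [Function.update_of_ne hip] using H1 i ⟨hip, hi⟩
    rw [e, Measure.prod_prod, Measure.infinitePi_pi _ (fun i _ => ht i), mul_comm,
      Finset.mul_prod_erase s (fun i => μ i (t i)) hp]
  · have e : (fun z : ((i : ι) → X i) × X p => Function.update z.1 p z.2) ⁻¹'
        (Set.pi s t) = (Set.pi s t) ×ˢ Set.univ := by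
      ext z
      simp only [Set.mem_preimage, Set.mem_pi, Finset.mem_coe, Set.mem_prod, Set.mem_univ,
        and_true]
      refine forall₂_congr fun i hi => ?_
      rw [Function.update_of_ne (fun hip : i = p => hp (hip ▸ hi))]
    rw [e, Measure.prod_prod, Measure.infinitePi_pi _ (fun i _ => ht i)]
    simp

/-- Fubini with respect to one coordinate, in a form where the integrand still depends on the whole
configuration. -/
theorem lintegral_infinitePi_update (μ : (i : ι) → Measure (X i))
    [∀ i, IsProbabilityMeasure (μ i)] (p : ι) {f : ((i : ι) → X i) → ENNReal}
    (hf : Measurable f) :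
    ∫⁻ ω, f ω ∂(Measure.infinitePi μ) =
      ∫⁻ y, ∫⁻ ω, f (Function.update ω p y) ∂(Measure.infinitePi μ) ∂(μ p) := by
  conv_lhs => rw [← map_update_infinitePi μ p]
  rw [lintegral_map hf (measurable_update_prod p)]
  exact lintegral_prod_symm _ (hf.comp (measurable_update_prod p)).aemeasurable

end Resampling

/-- The exponential moment of an exponential variable. -/
theorem lintegral_exp_mul_expMeasure {r z : ℝ} (hr : 0 < r) (hz : z < r) :
    ∫⁻ t, ENNReal.ofReal (Real.exp (z * t)) ∂(expMeasure r) = ENNReal.ofReal (r / (r - z)) := by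
  have hrz : 0 < r - z := sub_pos.mpr hz
  have e : expMeasure r = volume.withDensity (exponentialPDF r) := rfl
  have hpdf : ∀ r, Measurable (exponentialPDF r) := fun r =>
    (measurable_exponentialPDFReal r).ennreal_ofReal
  rw [e, lintegral_withDensity_eq_lintegral_mul _ (hpdf r) (by fun_prop)]
  have e2 : ∀ t, (exponentialPDF r * fun t => ENNReal.ofReal (Real.exp (z * t))) t =
      ENNReal.ofReal (r / (r - z)) * exponentialPDF (r - z) t := by
    intro t
    rcases lt_or_ge t 0 with ht | ht
    · simp [exponentialPDF_of_neg ht]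
    · rw [Pi.mul_apply, exponentialPDF_of_nonneg ht, exponentialPDF_of_nonneg ht,
        ← ENNReal.ofReal_mul (by positivity), ← ENNReal.ofReal_mul (by positivity)]
      congr 1
      rw [mul_assoc, ← Real.exp_add, ← mul_assoc, div_mul_cancel₀ _ hrz.ne']
      congr 2
      ring
  simp_rw [e2]
  rw [lintegral_const_mul _ (hpdf (r - z)),
    lintegral_exponentialPDF_eq_one hrz, mul_one]

theorem h_pos {m : ℕ} (hm : 0 < m) : 0 < h m := by
  obtain ⟨k, rfl⟩ := Nat.exists_eq_succ_of_ne_zero hm.ne'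
  exact h_succ_pos k

theorem h_zero : h 0 = 0 := by simp [h]

theorem h_succ (m : ℕ) : h (m + 1) = h m + 1 / ((m : ℝ) + 1) := by
  simp [h_eq_sum, Finset.sum_range_succ]

theorem h_mono : Monotone h :=
  monotone_nat_of_le_succ fun m => by rw [h_succ]; linarith [show 0 ≤ 1 / ((m : ℝ) + 1) by positivity]

theorem one_le_h {m : ℕ} (hm : 0 < m) : 1 ≤ h m := by
  have := h_mono (show 1 ≤ m from hm)
  simpa [h_succ, h_zero] using this

/-- `expMoment z w m` is the expectation of `exp (z D + w L)` for the tree with `m + 1` leaves,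
described by the recursion that comes from following a uniform random leaf through the first
split: from `m + 1` leaves, it moves to a part with `j + 1` leaves at rate `1 / (m - j)`. -/
noncomputable def expMoment (z w : ℝ) : ℕ → ℝ
  | 0 => 1
  | k + 1 => Real.exp w / (h (k + 1) - z) *
      ∑ j : Fin (k + 1), expMoment z w j / ((k : ℝ) + 1 - (j : ℕ))

theorem expMoment_zero (z w : ℝ) : expMoment z w 0 = 1 := by rw [expMoment]

theorem expMoment_succ (z w : ℝ) (k : ℕ) :
    expMoment z w (k + 1) = Real.exp w / (h (k + 1) - z) *
      ∑ j ∈ Finset.range (k + 1), expMoment z w j / ((k : ℝ) + 1 - j) := by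
  rw [expMoment, Fin.sum_univ_eq_sum_range (fun j => expMoment z w j / ((k : ℝ) + 1 - j)) (k + 1)]

theorem expMoment_pos {z : ℝ} (hz : z < 1) (w : ℝ) (m : ℕ) : 0 < expMoment z w m := by
  induction m using Nat.strong_induction_on with
  | _ m ih =>
    cases m with
    | zero => simp [expMoment_zero]
    | succ k =>
      rw [expMoment_succ]
      have h1 : 0 < h (k + 1) - z := by linarith [one_le_h (Nat.succ_pos k)]
      refine mul_pos (by positivity) (Finset.sum_pos (fun j hj => ?_) ⟨0, by simp⟩)
      have hj' := Finset.mem_range.mp hj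
      have : (j : ℝ) < k + 1 := by exact_mod_cast hj'
      exact div_pos (ih j hj') (by linarith)

/-- The split probabilities turn the size-weighted recursion into the recursion defining
`expMoment`. -/
theorem sum_q_mul (f : ℕ → ℝ) (k : ℕ) :
    ∑ i : Fin (k + 1), q (k + 2) (i + 1) *
        (((i : ℕ) + 1 : ℝ) * f i + ((k : ℝ) + 1 - (i : ℕ)) * f (k - i)) =
      ((k : ℝ) + 2) / h (k + 1) * ∑ j ∈ Finset.range (k + 1), f j / ((k : ℝ) + 1 - j) := by
  have hp : 0 < h (k + 1) := h_succ_pos k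
  rw [Fin.sum_univ_eq_sum_range (fun i => q (k + 2) (i + 1) *
    (((i : ℕ) + 1 : ℝ) * f i + ((k : ℝ) + 1 - (i : ℕ)) * f (k - i))) (k + 1)]
  have e : ∀ i ∈ Finset.range (k + 1), q (k + 2) (i + 1) *
      (((i : ℕ) + 1 : ℝ) * f i + ((k : ℝ) + 1 - (i : ℕ)) * f (k - i)) =
      ((k : ℝ) + 2) / (2 * h (k + 1)) * (f i / ((k : ℝ) + 1 - i) +
        f (k + 1 - 1 - i) / ((k : ℝ) + 1 - (k + 1 - 1 - i : ℕ))) := by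
    intro i hi
    have hi' : i ≤ k := Nat.lt_succ_iff.mp (Finset.mem_range.mp hi)
    have hir : (i : ℝ) ≤ k := by exact_mod_cast hi'
    have h1 : (k : ℝ) + 1 - i ≠ 0 := by linarith
    have h2 : (k : ℝ) + 2 - (i + 1) ≠ 0 := by linarith
    have h3 : (i : ℝ) + 1 ≠ 0 := by positivity
    have h4 : (k : ℝ) + 1 - (k - i) ≠ 0 := by
      rw [show (k : ℝ) + 1 - (k - i) = i + 1 by ring]; exact h3
    simp only [q, Nat.add_sub_cancel, show k + 2 - 1 = k + 1 from rfl]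
    push_cast [Nat.cast_sub hi']
    rw [show (k : ℝ) + 2 - (i + 1) = k + 1 - i by ring,
      show (k : ℝ) + 1 - (k - i) = i + 1 by ring]
    field_simp
  rw [Finset.sum_congr rfl e, ← Finset.mul_sum, Finset.sum_add_distrib,
    Finset.sum_range_reflect (fun j => f j / ((k : ℝ) + 1 - j)) (k + 1)]
  field_simp
  ring

namespace SplitTree

/-- The sum over all leaves of `exp (z * time-height + w * edge-height)`. -/
noncomputable def leafSum (z w : ℝ) : SplitTree → ENNReal
  | leaf => 1
  | node t l r => ENNReal.ofReal (Real.exp (z * t)) * ENNReal.ofReal (Real.exp w) *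
      (l.leafSum z w + r.leafSum z w)

theorem leafSum_eq (z w : ℝ) (T : SplitTree) :
    T.leafSum z w = ∑ x ∈ Finset.range T.numLeaves,
      ENNReal.ofReal (Real.exp (z * T.timeHeight x + w * T.edgeHeight x)) := by
  induction T with
  | leaf => simp [leafSum, numLeaves, timeHeight, edgeHeight]
  | node t l r ihl ihr =>
    rw [leafSum, ihl, ihr, numLeaves, Finset.sum_range_add, mul_add, Finset.mul_sum,
      Finset.mul_sum]
    congr 1
    · refine Finset.sum_congr rfl fun x hx => ?_
      rw [timeHeight, edgeHeight, if_pos (Finset.mem_range.mp hx),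
        if_pos (Finset.mem_range.mp hx), ← ENNReal.ofReal_mul (Real.exp_nonneg _),
        ← ENNReal.ofReal_mul (by positivity), ← Real.exp_add, ← Real.exp_add]
      push_cast
      congr 2
      ring
    · refine Finset.sum_congr rfl fun x _ => ?_
      rw [timeHeight, edgeHeight, if_neg (by simp), if_neg (by simp), Nat.add_sub_cancel_left,
        ← ENNReal.ofReal_mul (Real.exp_nonneg _),
        ← ENNReal.ofReal_mul (by positivity), ← Real.exp_add, ← Real.exp_add]
      push_cast
      congr 2
      ring

end SplitTree

theorem splitTree_one (ω : Config) (a : ℕ) : splitTree ω a 1 = .leaf := by rw [splitTree]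

theorem splitTree_add_two (ω : Config) (a k : ℕ) :
    splitTree ω a (k + 2) = .node (ω (a, k)).2
        (splitTree ω a ((ω (a, k)).1.val + 1))
        (splitTree ω (a + ((ω (a, k)).1.val + 1)) (k - (ω (a, k)).1.val + 1)) := by
  rw [splitTree]
  have := (ω (a, k)).1.isLt
  congr 2
  omega

theorem numLeaves_splitTree (ω : Config) (m : ℕ) :
    ∀ a, (splitTree ω a (m + 1)).numLeaves = m + 1 := by
  induction m using Nat.strong_induction_on with
  | _ m ih =>
    intro a
    cases m with
    | zero => rw [splitTree_one]; rfl
    | succ k =>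
      have hlt := (ω (a, k)).1.isLt
      rw [splitTree_add_two, SplitTree.numLeaves, ih _ hlt, ih _ (by omega)]
      omega

/-- The tree on an interval of at most `k + 1` elements does not depend on the split of an interval
with `k + 2` elements. -/
theorem splitTree_update (ω : Config) (p : ℕ × ℕ) (y : Fin (p.2 + 1) × ℝ) (m : ℕ)
    (hm : m ≤ p.2) :
    ∀ a, splitTree (Function.update ω p y) a (m + 1) = splitTree ω a (m + 1) := by
  induction m using Nat.strong_induction_on with
  | _ m ih =>
    intro a
    cases m with
    | zero => rw [splitTree_one, splitTree_one]
    | succ k =>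
      have hne : (a, k) ≠ p := by rintro rfl; simp at hm
      have hlt := (ω (a, k)).1.isLt
      rw [splitTree_add_two, splitTree_add_two, Function.update_of_ne hne,
        ih _ hlt (by omega), ih _ (by omega) (by omega)]

/-- A function of the configuration that is selected by a split is measurable. -/
theorem measurable_dep {β : Type*} [MeasurableSpace β] (a k : ℕ)
    (F : Fin (k + 1) → Config → β) (hF : ∀ i, Measurable (F i)) :
    Measurable (fun ω : Config => F (ω (a, k)).1 ω) := by
  have h1 : Measurable (fun p : Fin (k + 1) × Config => F p.1 p.2) :=
    measurable_from_prod_countable_right (fun i => hF i)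
  have h2 : Measurable (fun ω : Config => ((ω (a, k)).1, ω)) :=
    ((measurable_pi_apply (a, k)).fst).prodMk measurable_id
  exact h1.comp h2

theorem measurable_timeHeight_splitTree (m : ℕ) :
    ∀ a x, Measurable (fun ω : Config => (splitTree ω a (m + 1)).timeHeight x) := by
  induction m using Nat.strong_induction_on with
  | _ m ih =>
    intro a x
    cases m with
    | zero => simp only [zero_add, splitTree_one, SplitTree.timeHeight]; exact measurable_const
    | succ k =>
      simp only [splitTree_add_two, SplitTree.timeHeight, numLeaves_splitTree]
      refine (measurable_pi_apply (a, k)).snd.add ?_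
      refine measurable_dep a k (fun i ω => if x < i.val + 1 then
        (splitTree ω a (i.val + 1)).timeHeight x else
        (splitTree ω (a + (i.val + 1)) (k - i.val + 1)).timeHeight (x - (i.val + 1))) fun i => ?_
      have hi := i.isLt
      split_ifs
      · exact ih _ hi _ _
      · exact ih _ (by omega) _ _

theorem measurable_edgeHeight_splitTree (m : ℕ) :
    ∀ a x, Measurable (fun ω : Config => (splitTree ω a (m + 1)).edgeHeight x) := by
  induction m using Nat.strong_induction_on with
  | _ m ih =>
    intro a x
    cases m with
    | zero => simp only [zero_add, splitTree_one, SplitTree.edgeHeight]; exact measurable_const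
    | succ k =>
      simp only [splitTree_add_two, SplitTree.edgeHeight, numLeaves_splitTree]
      refine measurable_const.add ?_
      refine measurable_dep a k (fun i ω => if x < i.val + 1 then
        (splitTree ω a (i.val + 1)).edgeHeight x else
        (splitTree ω (a + (i.val + 1)) (k - i.val + 1)).edgeHeight (x - (i.val + 1))) fun i => ?_
      have hi := i.isLt
      split_ifs
      · exact ih _ hi _ _
      · exact ih _ (by omega) _ _

theorem measurable_leafSum_splitTree (z w : ℝ) (m a : ℕ) :
    Measurable (fun ω : Config => (splitTree ω a (m + 1)).leafSum z w) := by
  simp only [SplitTree.leafSum_eq, numLeaves_splitTree]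
  refine Finset.measurable_sum _ fun x _ => ENNReal.measurable_ofReal.comp
    (Real.measurable_exp.comp ?_)
  have h1 := measurable_timeHeight_splitTree m a x
  have h2 : Measurable (fun ω : Config => ((splitTree ω a (m + 1)).edgeHeight x : ℝ)) :=
    measurable_from_nat.comp (measurable_edgeHeight_splitTree m a x)
  exact (h1.const_mul z).add (h2.const_mul w)

/-- The expected sum over the leaves is the number of leaves times the moment for a uniform random
leaf. The starting point `a` of the interval plays no role. -/
theorem lintegral_leafSum {z : ℝ} (hz : z < 1) (w : ℝ) (m : ℕ) :
    ∀ a, ∫⁻ ω, (splitTree ω a (m + 1)).leafSum z w ∂configMeasure =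
      ENNReal.ofReal (((m : ℝ) + 1) * expMoment z w m) := by
  induction m using Nat.strong_induction_on with
  | _ m ih =>
    intro a
    cases m with
    | zero =>
      simp only [zero_add, splitTree_one, SplitTree.leafSum, lintegral_const, measure_univ,
        expMoment_zero]
      simp
    | succ k =>
      have hk1 : 1 ≤ h (k + 1) := one_le_h k.succ_pos
      have hhz : 0 < h (k + 1) - z := by linarith
      have := isProbabilityMeasure_expMeasure (h_succ_pos k)
      rw [configMeasure, lintegral_infinitePi_update _ (a, k)
        (measurable_leafSum_splitTree z w (k + 1) a), ← configMeasure]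
      -- conditionally on the first split and holding time, the two subtrees are fresh
      have step : ∀ y : Fin (k + 1) × ℝ,
          ∫⁻ ω, (splitTree (Function.update ω (a, k) y) a (k + 1 + 1)).leafSum z w
            ∂configMeasure =
          ENNReal.ofReal (((y.1 : ℕ) + 1 : ℝ) * expMoment z w y.1 +
              ((k : ℝ) + 1 - (y.1 : ℕ)) * expMoment z w (k - y.1)) *
            (ENNReal.ofReal (Real.exp w) * ENNReal.ofReal (Real.exp (z * y.2))) := by
        rintro ⟨i, t⟩
        have hi := i.isLt
        have hik : (i : ℕ) ≤ k := by omega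
        have hir : ((i : ℕ) : ℝ) ≤ k := by exact_mod_cast hik
        have p1 := expMoment_pos hz w i
        have p2 := expMoment_pos hz w (k - i)
        have e : ∀ ω : Config,
            (splitTree (Function.update ω (a, k) (i, t)) a (k + 1 + 1)).leafSum z w =
            ENNReal.ofReal (Real.exp (z * t)) * ENNReal.ofReal (Real.exp w) *
              ((splitTree ω a (i + 1)).leafSum z w +
                (splitTree ω (a + (i + 1)) (k - i + 1)).leafSum z w) := by
          intro ω
          rw [splitTree_add_two, SplitTree.leafSum]
          simp only [Function.update_self]
          rw [splitTree_update ω (a, k) (i, t) i hik,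
            splitTree_update ω (a, k) (i, t) (k - i) (by simp)]
        simp_rw [e]
        rw [lintegral_const_mul' _ _ (ENNReal.mul_ne_top ENNReal.ofReal_ne_top
            ENNReal.ofReal_ne_top),
          lintegral_add_left (measurable_leafSum_splitTree z w _ _),
          ih _ hi, ih _ (by omega), ← ENNReal.ofReal_add (by positivity) (by positivity),
          mul_comm, mul_comm (ENNReal.ofReal (Real.exp w))]
        push_cast [Nat.cast_sub hik]
        congr 3
        ring
      simp_rw [step]
      rw [nodeMeasure]
      have hcont : Measurable (fun i : Fin (k + 1) => ENNReal.ofReal (((i : ℕ) + 1 : ℝ) *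
          expMoment z w i + ((k : ℝ) + 1 - (i : ℕ)) * expMoment z w (k - i))) :=
        measurable_of_countable _
      have hexp : Measurable (fun t : ℝ =>
          ENNReal.ofReal (Real.exp w) * ENNReal.ofReal (Real.exp (z * t))) := by fun_prop
      rw [lintegral_prod_mul hcont.aemeasurable hexp.aemeasurable,
        lintegral_const_mul _ (by fun_prop), lintegral_exp_mul_expMeasure (by linarith) (by linarith),
        lintegral_fintype]
      have e3 : ∀ i : Fin (k + 1), ENNReal.ofReal (((i : ℕ) + 1 : ℝ) *
          expMoment z w i + ((k : ℝ) + 1 - (i : ℕ)) * expMoment z w (k - i)) *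
            (splitPMF k).toMeasure {i} =
          ENNReal.ofReal (q (k + 2) (i + 1) * (((i : ℕ) + 1 : ℝ) *
          expMoment z w i + ((k : ℝ) + 1 - (i : ℕ)) * expMoment z w (k - i))) := by
        intro i
        rw [PMF.toMeasure_apply_singleton _ _ (MeasurableSet.singleton i), splitPMF,
          PMF.ofFintype_apply, mul_comm, ENNReal.ofReal_mul (q_nonneg k i)]
      simp_rw [e3]
      rw [← ENNReal.ofReal_sum_of_nonneg, sum_q_mul, ← ENNReal.ofReal_mul (by positivity),
        ← ENNReal.ofReal_mul', expMoment_succ]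
      · congr 1
        push_cast
        field_simp
        ring
      · positivity
      · intro i _
        have hir : ((i : ℕ) : ℝ) ≤ k := by exact_mod_cast (show (i : ℕ) ≤ k by omega)
        have p1 := expMoment_pos hz w i
        have p2 := expMoment_pos hz w (k - i)
        have : 0 ≤ ((k : ℝ) + 1 - (i : ℕ)) := by linarith
        exact mul_nonneg (q_nonneg k i) (by positivity)

theorem measurable_D (n : ℕ) [NeZero n] : Measurable (D n) := by
  obtain ⟨m, rfl⟩ := Nat.exists_eq_succ_of_ne_zero (NeZero.ne n)
  exact measurable_from_prod_countable_left fun x => measurable_timeHeight_splitTree m 0 x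

theorem measurable_L (n : ℕ) [NeZero n] : Measurable (L n) := by
  obtain ⟨m, rfl⟩ := Nat.exists_eq_succ_of_ne_zero (NeZero.ne n)
  exact measurable_from_prod_countable_left fun x => measurable_edgeHeight_splitTree m 0 x

theorem measurable_L_real (n : ℕ) [NeZero n] : Measurable (fun s => (L n s : ℝ)) :=
  measurable_from_nat.comp (measurable_L n)

theorem lintegral_exp_D_L {z : ℝ} (hz : z < 1) (w : ℝ) (m : ℕ) :
    ∫⁻ s, ENNReal.ofReal (Real.exp (z * D (m + 1) s + w * L (m + 1) s)) ∂(sampleMeasure (m + 1)) =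
      ENNReal.ofReal (expMoment z w m) := by
  have hmeas : Measurable (fun s => ENNReal.ofReal
      (Real.exp (z * D (m + 1) s + w * L (m + 1) s))) :=
    ENNReal.measurable_ofReal.comp (Real.measurable_exp.comp
      (((measurable_D (m + 1)).const_mul z).add ((measurable_L_real (m + 1)).const_mul w)))
  rw [sampleMeasure, lintegral_prod _ hmeas.aemeasurable]
  have e : ∀ ω : Config, ∫⁻ x, ENNReal.ofReal
      (Real.exp (z * D (m + 1) (ω, x) + w * L (m + 1) (ω, x)))
        ∂(PMF.uniformOfFintype (Fin (m + 1))).toMeasure =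
      ENNReal.ofReal (1 / ((m : ℝ) + 1)) * (splitTree ω 0 (m + 1)).leafSum z w := by
    intro ω
    rw [lintegral_fintype, SplitTree.leafSum_eq, numLeaves_splitTree, Finset.mul_sum,
      ← Fin.sum_univ_eq_sum_range (fun x => ENNReal.ofReal (1 / ((m : ℝ) + 1)) *
        ENNReal.ofReal (Real.exp (z * (splitTree ω 0 (m + 1)).timeHeight x +
          w * (splitTree ω 0 (m + 1)).edgeHeight x))) (m + 1)]
    refine Finset.sum_congr rfl fun x _ => ?_
    rw [PMF.toMeasure_apply_singleton _ _ (MeasurableSet.singleton x),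
      PMF.uniformOfFintype_apply, mul_comm, Fintype.card_fin, one_div,
      ENNReal.ofReal_inv_of_pos (by positivity)]
    congr 2
    rw [← ENNReal.ofReal_natCast]
    push_cast
    rfl
  simp_rw [e]
  rw [lintegral_const_mul _ (measurable_leafSum_splitTree z w m 0), lintegral_leafSum hz,
    ← ENNReal.ofReal_mul (by positivity)]
  congr 1
  field_simp

/-- The joint exponential moments of the two heights of a uniform random leaf. -/
theorem integrable_exp_D_L {z : ℝ} (hz : z < 1) (w : ℝ) (m : ℕ) :
    Integrable (fun s => Real.exp (z * D (m + 1) s + w * L (m + 1) s)) (sampleMeasure (m + 1)) ∧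
    ∫ s, Real.exp (z * D (m + 1) s + w * L (m + 1) s) ∂(sampleMeasure (m + 1)) =
      expMoment z w m := by
  have hmeas : Measurable (fun s => Real.exp (z * D (m + 1) s + w * L (m + 1) s)) :=
    Real.measurable_exp.comp
      (((measurable_D (m + 1)).const_mul z).add ((measurable_L_real (m + 1)).const_mul w))
  have hnn : 0 ≤ᵐ[sampleMeasure (m + 1)]
      (fun s => Real.exp (z * D (m + 1) s + w * L (m + 1) s)) :=
    Eventually.of_forall fun s => (Real.exp_pos _).le
  constructor
  · rw [← lintegral_ofReal_ne_top_iff_integrable hmeas.aestronglyMeasurable hnn,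
      lintegral_exp_D_L hz]
    exact ENNReal.ofReal_ne_top
  · rw [integral_eq_lintegral_of_nonneg_ae hnn hmeas.aestronglyMeasurable, lintegral_exp_D_L hz,
      ENNReal.toReal_ofReal (expMoment_pos hz w m).le]

/-! ### Convergence of Laplace transforms, of moments, and in distribution -/

/-- The tail of the exponential series gains a factor `θ ^ K` when its argument is shrunk by `θ`. -/
theorem exp_tail_le {θ b : ℝ} (hθ0 : 0 ≤ θ) (hθ1 : θ ≤ 1) (hb : 0 ≤ b) (K : ℕ) :
    Real.exp (θ * b) - ∑ m ∈ Finset.range K, (θ * b) ^ m / m.factorial ≤ θ ^ K * Real.exp b := by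
  have hs : ∀ a : ℝ, HasSum (fun m : ℕ => a ^ m / m.factorial) (Real.exp a) := fun a => by
    rw [Real.exp_eq_exp_ℝ]; exact NormedSpace.expSeries_div_hasSum_exp a
  have h1 := (hs (θ * b)).summable.sum_add_tsum_nat_add K
  have h2 := (hs b).summable.sum_add_tsum_nat_add K
  rw [(hs (θ * b)).tsum_eq] at h1
  rw [(hs b).tsum_eq] at h2
  have h3 : ∑' m : ℕ, (θ * b) ^ (m + K) / (m + K).factorial ≤
      ∑' m : ℕ, θ ^ K * (b ^ (m + K) / (m + K).factorial) := by
    refine Summable.tsum_le_tsum (fun m => ?_)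
      ((summable_nat_add_iff K).2 (hs (θ * b)).summable)
      (((summable_nat_add_iff K).2 (hs b).summable).mul_left _)
    rw [mul_pow, mul_div_assoc]
    refine mul_le_mul_of_nonneg_right ?_ (by positivity)
    exact pow_le_pow_of_le_one hθ0 hθ1 (Nat.le_add_left K m)
  rw [tsum_mul_left] at h3
  have h4 : 0 ≤ ∑ m ∈ Finset.range K, b ^ m / m.factorial :=
    Finset.sum_nonneg fun m _ => by positivity
  have h5 : 0 ≤ θ ^ K := by positivity
  nlinarith

theorem integrable_pow_of_exp_abs {μ : Measure ℝ} {r : ℝ} (hr : 0 < r)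
    (hi : Integrable (fun x => Real.exp (r * |x|)) μ) (k : ℕ) :
    Integrable (fun x : ℝ => x ^ k) μ := by
  refine (hi.const_mul (k.factorial / r ^ k)).mono' (by fun_prop) (ae_of_all _ fun x => ?_)
  have h1 := Real.pow_div_factorial_le_exp (r * |x|) (by positivity) k
  rw [mul_pow, div_le_iff₀ (by positivity)] at h1
  rw [Real.norm_eq_abs, abs_pow, div_mul_eq_mul_div, le_div_iff₀ (by positivity)]
  linarith

/-- Taylor expansion of the Laplace transform, with a geometrically small remainder. -/
theorem norm_integral_cexp_sub_sum_le {μ : Measure ℝ} {r θ : ℝ} (hr : 0 < r)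
    (hi : Integrable (fun x => Real.exp (r * |x|)) μ) (hθ0 : 0 ≤ θ) (hθ1 : θ ≤ 1) {s : ℂ}
    (hs : ‖s‖ = θ * r) (K : ℕ) :
    ‖∫ x, Complex.exp (s * x) ∂μ -
      ∑ j ∈ Finset.range K, s ^ j / j.factorial * ((∫ x, x ^ j ∂μ : ℝ) : ℂ)‖ ≤
      θ ^ K * ∫ x, Real.exp (r * |x|) ∂μ := by
  have hnorm : ∀ x : ℝ, ‖s * x‖ = θ * (r * |x|) := fun x => by
    rw [norm_mul, hs, Complex.norm_real, Real.norm_eq_abs, mul_assoc]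
  have hint : Integrable (fun x : ℝ => Complex.exp (s * x)) μ := by
    refine hi.mono' (by fun_prop) (ae_of_all _ fun x => ?_)
    refine (Complex.norm_exp_le_exp_norm _).trans (Real.exp_le_exp.mpr ?_)
    rw [hnorm]
    exact mul_le_of_le_one_left (by positivity) hθ1
  have hpow : ∀ j : ℕ, Integrable (fun x : ℝ => s ^ j / j.factorial * ((x ^ j : ℝ) : ℂ)) μ :=
    fun j => ((integrable_pow_of_exp_abs hr hi j).ofReal).const_mul _
  have e : ∀ j : ℕ, s ^ j / j.factorial * ((∫ x, x ^ j ∂μ : ℝ) : ℂ) =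
      ∫ x : ℝ, s ^ j / j.factorial * ((x ^ j : ℝ) : ℂ) ∂μ := fun j => by
    rw [integral_const_mul, integral_complex_ofReal]
  simp_rw [e]
  rw [← integral_finsetSum _ fun j _ => hpow j,
    ← integral_sub hint (integrable_finsetSum _ fun j _ => hpow j), ← integral_const_mul]
  refine norm_integral_le_of_norm_le (hi.const_mul _) (ae_of_all _ fun x => ?_)
  have h1 := Complex.norm_exp_sub_sum_le_exp_norm_sub_sum (s * x) K
  rw [hnorm] at h1
  refine le_trans (le_of_eq ?_) (h1.trans (exp_tail_le hθ0 hθ1 (by positivity) K))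
  congr 2
  refine Finset.sum_congr rfl fun j _ => ?_
  push_cast
  ring

section Curtiss

variable {μ : ℕ → Measure ℝ} {ν : Measure ℝ}

/-- The Laplace transforms of `μ n` converge to that of `ν`, in the weak sense that every real point
is the limit of points along which they converge. -/
def TendstoLaplace (μ : ℕ → Measure ℝ) (ν : Measure ℝ) : Prop :=
  ∀ u : ℝ, ∃ s : ℕ → ℝ, Tendsto s atTop (𝓝 u) ∧
    (∀ᶠ n in atTop, Integrable (fun x => Real.exp (s n * x)) (μ n)) ∧
    Tendsto (fun n => ∫ x, Real.exp (s n * x) ∂(μ n)) atTop (𝓝 (∫ x, Real.exp (u * x) ∂ν))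

theorem exp_mul_abs_le {a b r : ℝ} (ha : r ≤ a) (hb : b ≤ -r) (x : ℝ) :
    Real.exp (r * |x|) ≤ Real.exp (a * x) + Real.exp (b * x) := by
  rcases le_total 0 x with hx | hx
  · rw [abs_of_nonneg hx]
    have := Real.exp_le_exp.mpr (mul_le_mul_of_nonneg_right ha hx)
    linarith [Real.exp_pos (b * x)]
  · rw [abs_of_nonpos hx]
    have : Real.exp (r * -x) ≤ Real.exp (b * x) := Real.exp_le_exp.mpr (by nlinarith)
    linarith [Real.exp_pos (a * x)]

/-- Convergence of Laplace transforms gives eventually uniform two-sided exponential moments. -/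
theorem TendstoLaplace.eventually_bound (H : TendstoLaplace μ ν) (r : ℝ) :
    ∃ C, ∀ᶠ n in atTop, Integrable (fun x => Real.exp (r * |x|)) (μ n) ∧
      ∫ x, Real.exp (r * |x|) ∂(μ n) ≤ C := by
  obtain ⟨s, hs, hsi, hsl⟩ := H (r + 1)
  obtain ⟨t, ht, hti, htl⟩ := H (-(r + 1))
  refine ⟨(∫ x, Real.exp ((r + 1) * x) ∂ν + 1) + (∫ x, Real.exp (-(r + 1) * x) ∂ν + 1), ?_⟩
  filter_upwards [hs.eventually (lt_mem_nhds (show r < r + 1 by linarith)),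
    ht.eventually (gt_mem_nhds (show -(r + 1) < -r by linarith)), hsi, hti,
    hsl.eventually (gt_mem_nhds (lt_add_one _)), htl.eventually (gt_mem_nhds (lt_add_one _))]
    with n h1 h2 h3 h4 h5 h6
  have hi : Integrable (fun x => Real.exp (r * |x|)) (μ n) := by
    refine (h3.add h4).mono' (by fun_prop) (ae_of_all _ fun x => ?_)
    rw [Real.norm_eq_abs, Real.abs_exp]
    exact exp_mul_abs_le h1.le h2.le x
  refine ⟨hi, ?_⟩
  calc ∫ x, Real.exp (r * |x|) ∂(μ n)
      ≤ ∫ x, (Real.exp (s n * x) + Real.exp (t n * x)) ∂(μ n) :=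
        integral_mono hi (h3.add h4) fun x => exp_mul_abs_le h1.le h2.le x
    _ = _ := integral_add h3 h4
    _ ≤ _ := add_le_add h5.le h6.le

theorem abs_exp_mul_sub_exp_mul_le {a b r : ℝ} (ha : |a| ≤ r) (hb : |b| ≤ r) (x : ℝ) :
    |Real.exp (a * x) - Real.exp (b * x)| ≤ |a - b| * Real.exp ((r + 1) * |x|) := by
  wlog hab : b * x ≤ a * x generalizing a b
  · rw [abs_sub_comm, abs_sub_comm a b]
    exact this hb ha (le_of_not_ge hab)
  have h1 : Real.exp (b * x) ≤ Real.exp (a * x) := Real.exp_le_exp.mpr hab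
  rw [abs_of_nonneg (sub_nonneg.mpr h1)]
  have h2 : Real.exp (a * x) * (1 - (a * x - b * x)) ≤ Real.exp (b * x) := by
    have h3 : 1 - (a * x - b * x) ≤ Real.exp (b * x - a * x) := by
      linarith [Real.add_one_le_exp (b * x - a * x)]
    calc _ ≤ Real.exp (a * x) * Real.exp (b * x - a * x) :=
          mul_le_mul_of_nonneg_left h3 (Real.exp_nonneg _)
      _ = _ := by rw [← Real.exp_add]; congr 1; ring
  have h4 : a * x - b * x ≤ |a - b| * |x| := by
    rw [← abs_mul, sub_mul]; exact le_abs_self _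
  have h5 : Real.exp (a * x) ≤ Real.exp (r * |x|) := by
    refine Real.exp_le_exp.mpr ((le_abs_self _).trans ?_)
    rw [abs_mul]; exact mul_le_mul_of_nonneg_right ha (abs_nonneg x)
  have h6 : |x| ≤ Real.exp |x| := by linarith [Real.add_one_le_exp |x|]
  calc Real.exp (a * x) - Real.exp (b * x) ≤ Real.exp (a * x) * (a * x - b * x) := by linarith
    _ ≤ Real.exp (r * |x|) * (|a - b| * Real.exp |x|) := by
        refine mul_le_mul h5 (h4.trans (mul_le_mul_of_nonneg_left h6 (abs_nonneg _)))
          (by linarith) (Real.exp_nonneg _)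
    _ = _ := by rw [add_mul, one_mul, Real.exp_add]; ring

theorem integrable_exp_mul_of_abs {μ : Measure ℝ} {r a : ℝ} (ha : |a| ≤ r)
    (hi : Integrable (fun x => Real.exp (r * |x|)) μ) :
    Integrable (fun x => Real.exp (a * x)) μ := by
  refine hi.mono' (by fun_prop) (ae_of_all _ fun x => ?_)
  rw [Real.norm_eq_abs, Real.abs_exp]
  refine Real.exp_le_exp.mpr ((le_abs_self _).trans ?_)
  rw [abs_mul]; exact mul_le_mul_of_nonneg_right ha (abs_nonneg x)

theorem TendstoLaplace.tendsto_integral_exp (H : TendstoLaplace μ ν) (u : ℝ) :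
    Tendsto (fun n => ∫ x, Real.exp (u * x) ∂(μ n)) atTop (𝓝 (∫ x, Real.exp (u * x) ∂ν)) := by
  obtain ⟨s, hs, hsi, hsl⟩ := H u
  obtain ⟨C, hC⟩ := H.eventually_bound (|u| + 1 + 1)
  have hd : Tendsto (fun n => ∫ x, Real.exp (u * x) ∂(μ n) - ∫ x, Real.exp (s n * x) ∂(μ n))
      atTop (𝓝 0) := by
    refine squeeze_zero_norm' (a := fun n => |u - s n| * C) ?_ ?_
    · filter_upwards [hC, hsi, (continuous_abs.continuousAt.tendsto.comp hs).eventually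
        (gt_mem_nhds (lt_add_one |u|))] with n h1 h2 h3
      have hu : |u| ≤ |u| + 1 := by linarith
      have hui := integrable_exp_mul_of_abs (a := u) (by linarith) h1.1
      rw [← integral_sub hui h2]
      calc _ ≤ ∫ x, |u - s n| * Real.exp ((|u| + 1 + 1) * |x|) ∂(μ n) :=
            norm_integral_le_of_norm_le (h1.1.const_mul _)
              (ae_of_all _ fun x => abs_exp_mul_sub_exp_mul_le hu h3.le x)
        _ = |u - s n| * ∫ x, Real.exp ((|u| + 1 + 1) * |x|) ∂(μ n) := integral_const_mul _ _
        _ ≤ _ := mul_le_mul_of_nonneg_left h1.2 (abs_nonneg _)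
    · have : Tendsto (fun n => |u - s n| * C) atTop (𝓝 (|u - u| * C)) :=
        ((tendsto_const_nhds.sub hs).abs).mul_const C
      simpa using this
  simpa using hd.add hsl

theorem tendsto_of_forall_eventually_dist_le {E : Type*} [PseudoMetricSpace E] {f : ℕ → E} {a : E}
    {b : ℕ → ℝ} (hb : Tendsto b atTop (𝓝 0)) (hf : ∀ K, ∀ᶠ n in atTop, dist (f n) a ≤ b K) :
    Tendsto f atTop (𝓝 a) := by
  rw [Metric.tendsto_nhds]
  intro ε hε
  obtain ⟨K, hK⟩ := (hb.eventually (gt_mem_nhds hε)).exists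
  filter_upwards [hf K] with n hn using hn.trans_lt hK

/-- Convergence of Laplace transforms implies convergence of all moments: the moments are the Taylor
coefficients, which are recovered one after the other. -/
theorem TendstoLaplace.tendsto_moment (H : TendstoLaplace μ ν)
    (hν : ∀ r, Integrable (fun x => Real.exp (r * |x|)) ν) (k : ℕ) :
    Tendsto (fun n => ∫ x, x ^ k ∂(μ n)) atTop (𝓝 (∫ x, x ^ k ∂ν)) := by
  induction k using Nat.strong_induction_on with
  | _ k ih =>
    obtain ⟨C, hC⟩ := H.eventually_bound 1
    set C' := ∫ x, Real.exp (1 * |x|) ∂ν with hC'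
    refine tendsto_of_forall_eventually_dist_le
      (b := fun K : ℕ => (k.factorial : ℝ) * (1 + C + C') * (1 / ((K : ℝ) + 1))) ?_ fun K => ?_
    · simpa using (tendsto_one_div_add_atTop_nhds_zero_nat (𝕜 := ℝ)).const_mul
        ((k.factorial : ℝ) * (1 + C + C'))
    set u : ℝ := 1 / ((K : ℝ) + 1) with hu
    have hu0 : 0 < u := by positivity
    have hu1 : u ≤ 1 := by rw [hu, div_le_one (by positivity)]; linarith [K.cast_nonneg (α := ℝ)]
    have hlow : Tendsto (fun n => |∫ x, Real.exp (u * x) ∂(μ n) - ∫ x, Real.exp (u * x) ∂ν| +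
        ∑ j ∈ Finset.range k, u ^ j / j.factorial * |∫ x, x ^ j ∂(μ n) - ∫ x, x ^ j ∂ν|)
        atTop (𝓝 0) := by
      have t1 : Tendsto (fun n => |∫ x, Real.exp (u * x) ∂(μ n) - ∫ x, Real.exp (u * x) ∂ν|)
          atTop (𝓝 0) := by
        simpa using ((H.tendsto_integral_exp u).sub_const (∫ x, Real.exp (u * x) ∂ν)).abs
      have t2 : Tendsto (fun n => ∑ j ∈ Finset.range k,
          u ^ j / j.factorial * |∫ x, x ^ j ∂(μ n) - ∫ x, x ^ j ∂ν|) atTop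
          (𝓝 (∑ j ∈ Finset.range k, u ^ j / j.factorial * 0)) := by
        refine tendsto_finsetSum _ fun j hj => Tendsto.const_mul _ ?_
        simpa using ((ih j (Finset.mem_range.mp hj)).sub_const (∫ x, x ^ j ∂ν)).abs
      simpa using t1.add t2
    filter_upwards [hC, hlow.eventually (gt_mem_nhds (show 0 < u ^ (k + 1) by positivity))]
      with n h1 h2
    have key : ∀ {m : Measure ℝ}, Integrable (fun x => Real.exp (1 * |x|)) m →
        |∫ x, Real.exp (u * x) ∂m - ∑ j ∈ Finset.range (k + 1),
          u ^ j / j.factorial * ∫ x, x ^ j ∂m| ≤ u ^ (k + 1) * ∫ x, Real.exp (1 * |x|) ∂m := by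
      intro m hm
      have := norm_integral_cexp_sub_sum_le (s := (u : ℂ)) one_pos hm hu0.le hu1
        (by rw [Complex.norm_real, Real.norm_eq_abs, abs_of_pos hu0, mul_one]) (k + 1)
      rw [← Real.norm_eq_abs, ← Complex.norm_real]
      refine le_trans (le_of_eq ?_) this
      congr 1
      push_cast [← integral_complex_ofReal]
      rfl
    have k1 := key h1.1
    have k2 := key (hν 1)
    rw [← hC'] at k2
    rw [Finset.sum_range_succ] at k1 k2
    set A := ∫ x, Real.exp (u * x) ∂(μ n)
    set B := ∫ x, Real.exp (u * x) ∂ν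
    set SA := ∑ j ∈ Finset.range k, u ^ j / j.factorial * ∫ x, x ^ j ∂(μ n)
    set SB := ∑ j ∈ Finset.range k, u ^ j / j.factorial * ∫ x, x ^ j ∂ν
    have hS : |SA - SB| ≤
        ∑ j ∈ Finset.range k, u ^ j / j.factorial * |∫ x, x ^ j ∂(μ n) - ∫ x, x ^ j ∂ν| := by
      rw [← Finset.sum_sub_distrib]
      refine (Finset.abs_sum_le_sum_abs _ _).trans (le_of_eq (Finset.sum_congr rfl fun j _ => ?_))
      rw [← mul_sub, abs_mul, abs_of_nonneg (by positivity)]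
    have hup : 0 < u ^ (k + 1) := by positivity
    have hmain : u ^ k / k.factorial * |∫ x, x ^ k ∂(μ n) - ∫ x, x ^ k ∂ν| ≤
        u ^ (k + 1) * (1 + C + C') := by
      rw [← abs_of_nonneg (show 0 ≤ u ^ k / k.factorial by positivity), ← abs_mul, mul_sub]
      have k3 : u ^ (k + 1) * ∫ x, Real.exp (1 * |x|) ∂(μ n) ≤ u ^ (k + 1) * C :=
        mul_le_mul_of_nonneg_left h1.2 hup.le
      rw [abs_le] at k1 k2 hS ⊢
      have hAB := abs_le.mp (le_refl |A - B|)
      constructor <;> nlinarith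
    rw [Real.dist_eq]
    have hfac : (0 : ℝ) < k.factorial := by positivity
    rw [div_mul_eq_mul_div, div_le_iff₀ hfac, pow_succ, mul_assoc, mul_assoc] at hmain
    have := le_of_mul_le_mul_left hmain (by positivity : 0 < u ^ k)
    linarith

/-- The characteristic functions converge, since their Taylor expansions have uniformly small
remainders and coefficients that converge. -/
theorem TendstoLaplace.tendsto_charFun (H : TendstoLaplace μ ν)
    (hν : ∀ r, Integrable (fun x => Real.exp (r * |x|)) ν) (t : ℝ) :
    Tendsto (fun n => charFun (μ n) t) atTop (𝓝 (charFun ν t)) := by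
  have hr : 0 < 2 * |t| + 2 := by positivity
  obtain ⟨C, hC⟩ := H.eventually_bound (2 * |t| + 2)
  set r := 2 * |t| + 2 with hrdef
  set C' := ∫ x, Real.exp (r * |x|) ∂ν with hC'
  set θ := |t| / r
  have hθ0 : 0 ≤ θ := by positivity
  have hθ1 : θ < 1 := by rw [div_lt_one hr]; linarith [abs_nonneg t]
  have hs : ‖(t * Complex.I : ℂ)‖ = θ * r := by
    rw [norm_mul, Complex.norm_I, mul_one, Complex.norm_real, Real.norm_eq_abs,
      div_mul_cancel₀ _ hr.ne']
  have hcf : ∀ m : Measure ℝ, charFun m t = ∫ x : ℝ, Complex.exp (t * Complex.I * x) ∂m :=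
    fun m => by
      rw [charFun_apply_real]
      congr 1 with x
      congr 1
      ring
  have hpow0 := tendsto_pow_atTop_nhds_zero_of_lt_one hθ0 hθ1
  refine tendsto_of_forall_eventually_dist_le
      (b := fun K : ℕ => θ ^ K * C + 1 / ((K : ℝ) + 1) + θ ^ K * C') ?_ fun K => ?_
  · simpa using ((hpow0.mul_const C).add
      (tendsto_one_div_add_atTop_nhds_zero_nat (𝕜 := ℝ))).add (hpow0.mul_const C')
  have hmid : Tendsto (fun n => ∑ j ∈ Finset.range K,
      (t * Complex.I : ℂ) ^ j / j.factorial * ((∫ x, x ^ j ∂(μ n) : ℝ) : ℂ)) atTop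
      (𝓝 (∑ j ∈ Finset.range K,
      (t * Complex.I : ℂ) ^ j / j.factorial * ((∫ x, x ^ j ∂ν : ℝ) : ℂ))) := by
    refine tendsto_finsetSum _ fun j _ => Tendsto.const_mul _ ?_
    exact (Complex.continuous_ofReal.tendsto _).comp (H.tendsto_moment hν j)
  filter_upwards [hC, Metric.tendsto_nhds.mp hmid (1 / ((K : ℝ) + 1)) (by positivity)] with n h1 h2
  have k1 := norm_integral_cexp_sub_sum_le hr h1.1 hθ0 hθ1.le hs K
  have k2 := norm_integral_cexp_sub_sum_le hr (hν r) hθ0 hθ1.le hs K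
  rw [← hcf, ← dist_eq_norm] at k1 k2
  have k3 : θ ^ K * ∫ x, Real.exp (r * |x|) ∂(μ n) ≤ θ ^ K * C :=
    mul_le_mul_of_nonneg_left h1.2 (by positivity)
  rw [dist_comm] at k2
  exact (dist_triangle4 _ _ _ _).trans (add_le_add (add_le_add (k1.trans k3) h2.le) k2)

end Curtiss

/-! ### Harmonic sums and values of the zeta function -/

/-- The generalized harmonic sum `1 + 1/2^p + ... + 1/m^p`. -/
noncomputable def harmPow (p m : ℕ) : ℝ := ∑ k ∈ Finset.range m, 1 / ((k : ℝ) + 1) ^ p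

theorem harmPow_succ (p m : ℕ) : harmPow p (m + 1) = harmPow p m + 1 / ((m : ℝ) + 1) ^ p := by
  rw [harmPow, Finset.sum_range_succ, harmPow]

theorem harmPow_mono (p : ℕ) : Monotone (harmPow p) :=
  monotone_nat_of_le_succ fun m => by
    rw [harmPow_succ]; linarith [show 0 ≤ 1 / ((m : ℝ) + 1) ^ p by positivity]

theorem one_le_harmPow (p : ℕ) {m : ℕ} (hm : 0 < m) : 1 ≤ harmPow p m := by
  have := harmPow_mono p (show 1 ≤ m from hm)
  simpa [harmPow] using this

theorem summable_harmPow {p : ℕ} (hp : 2 ≤ p) :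
    Summable (fun k : ℕ => 1 / ((k : ℝ) + 1) ^ p) := by
  have := (summable_nat_add_iff 1).2 (Real.summable_one_div_nat_pow (p := p).2 (by omega))
  simpa using this

theorem zetaReal_eq_tsum {p : ℕ} (hp : 2 ≤ p) :
    zetaReal p = ∑' k : ℕ, 1 / ((k : ℝ) + 1) ^ p := by
  have hs := Real.summable_one_div_nat_pow (p := p).2 (by omega)
  rw [zetaReal, zeta_nat_eq_tsum_of_gt_one (by omega)]
  have e : ∀ n : ℕ, 1 / (n : ℂ) ^ p = ((1 / (n : ℝ) ^ p : ℝ) : ℂ) := fun n => by push_cast; rfl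
  simp_rw [e]
  rw [← Complex.ofReal_tsum, Complex.ofReal_re, hs.tsum_eq_zero_add]
  simp [show p ≠ 0 by omega]

theorem tendsto_harmPow {p : ℕ} (hp : 2 ≤ p) :
    Tendsto (harmPow p) atTop (𝓝 (zetaReal p)) := by
  rw [zetaReal_eq_tsum hp]
  exact (summable_harmPow hp).hasSum.tendsto_sum_nat

theorem harmPow_le_zetaReal {p : ℕ} (hp : 2 ≤ p) (m : ℕ) : harmPow p m ≤ zetaReal p :=
  (harmPow_mono p).ge_of_tendsto (tendsto_harmPow hp) m

/-- The tail bound `∑ k > m, 1 / k ^ p ≤ 2 / (m + 1)`, by telescoping. -/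
theorem zetaReal_le {p : ℕ} (hp : 2 ≤ p) (m : ℕ) : zetaReal p ≤ harmPow p m + 2 / ((m : ℝ) + 1) := by
  have hanti : Antitone (fun m : ℕ => harmPow p m + 2 / ((m : ℝ) + 1)) := by
    refine antitone_nat_of_succ_le fun k => ?_
    rw [harmPow_succ]
    have h1 : 1 / ((k : ℝ) + 1) ^ p ≤ 1 / ((k : ℝ) + 1) ^ 2 :=
      one_div_le_one_div_of_le (by positivity)
        (pow_le_pow_right₀ (by linarith [k.cast_nonneg (α := ℝ)]) hp)
    have h2 : 2 / ((k : ℝ) + 1) - 2 / ((k : ℝ) + 1 + 1) - 1 / ((k : ℝ) + 1) ^ 2 =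
        k / (((k : ℝ) + 1) ^ 2 * (k + 1 + 1)) := by field_simp; ring
    have h3 : 0 ≤ (k : ℝ) / (((k : ℝ) + 1) ^ 2 * (k + 1 + 1)) := by positivity
    push_cast
    linarith
  have hlim : Tendsto (fun m : ℕ => harmPow p m + 2 / ((m : ℝ) + 1)) atTop
      (𝓝 (zetaReal p + 2 * 0)) := by
    refine (tendsto_harmPow hp).add ?_
    simpa [div_eq_mul_inv] using (tendsto_one_div_add_atTop_nhds_zero_nat (𝕜 := ℝ)).const_mul 2
  rw [mul_zero, add_zero] at hlim
  exact hanti.le_of_tendsto hlim m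

theorem one_le_zetaReal {p : ℕ} (hp : 2 ≤ p) : 1 ≤ zetaReal p :=
  (one_le_harmPow p one_pos).trans (harmPow_le_zetaReal hp 1)

theorem zetaReal_le_two {p : ℕ} (hp : 2 ≤ p) : zetaReal p ≤ 2 := by
  simpa [harmPow] using zetaReal_le hp 0

theorem harmPow_le_two {p : ℕ} (hp : 2 ≤ p) (m : ℕ) : harmPow p m ≤ 2 :=
  (harmPow_le_zetaReal hp m).trans (zetaReal_le_two hp)

theorem h_nonneg (m : ℕ) : 0 ≤ h m := by
  have := h_mono (Nat.zero_le m)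
  rwa [h_zero] at this

theorem h_le_self (m : ℕ) : h m ≤ m := by
  rw [h_eq_sum]
  calc ∑ i ∈ Finset.range m, 1 / ((i : ℝ) + 1) ≤ ∑ i ∈ Finset.range m, (1 : ℝ) :=
        Finset.sum_le_sum fun i _ => by
          rw [div_le_one (by positivity)]; linarith [i.cast_nonneg (α := ℝ)]
    _ = m := by simp

theorem log_le_h (m : ℕ) : Real.log ((m : ℝ) + 1) ≤ h m := by
  have := log_add_one_le_harmonic m
  push_cast at this
  exact this

theorem h_le_one_add_log (m : ℕ) : h m ≤ 1 + Real.log ((m : ℝ) + 1) := by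
  rcases Nat.eq_zero_or_pos m with rfl | hm
  · simp [h_zero]
  · have h1 := harmonic_le_one_add_log m
    have h2 : Real.log m ≤ Real.log ((m : ℝ) + 1) :=
      Real.log_le_log (by exact_mod_cast hm) (by linarith)
    unfold h
    linarith

theorem sum_inv_sub (m : ℕ) : ∑ j ∈ Finset.range m, 1 / ((m : ℝ) - j) = h m := by
  rw [h_eq_sum, ← Finset.sum_range_reflect (fun i : ℕ => 1 / ((i : ℝ) + 1))]
  refine Finset.sum_congr rfl fun j hj => ?_
  have hj' := Finset.mem_range.mp hj
  rw [Nat.sub_sub, Nat.cast_sub (by omega)]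
  push_cast
  congr 1
  ring

/-- A Gronwall inequality with respect to the harmonic sums. -/
theorem le_mul_exp_h {u : ℕ → ℝ} {c : ℝ} {j m : ℕ} (hjm : j ≤ m)
    (hu : ∀ k, j ≤ k → k < m → u (k + 1) ≤ u k * Real.exp (c * (1 / ((k : ℝ) + 1)))) :
    u m ≤ u j * Real.exp (c * (h m - h j)) := by
  induction m, hjm using Nat.le_induction with
  | base => simp
  | succ m hm ih =>
    have h1 := ih fun k hk hkm => hu k hk (by omega)
    refine (hu m hm (by omega)).trans ((mul_le_mul_of_nonneg_right h1 (Real.exp_nonneg _)).trans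
      (le_of_eq ?_))
    rw [mul_assoc, ← Real.exp_add, h_succ]
    congr 2
    ring

/-! ### Products that are nearly harmonic for the size-biased chain -/

/-- The product `∏ (1 + y_k / (k + 1))` over `k < m`. For constant `y = x` it is
`Γ(m + 1 + x) / (Γ(m + 1) Γ(1 + x))`, which behaves like `m ^ x`. -/
noncomputable def riseProd (y : ℕ → ℝ) (m : ℕ) : ℝ :=
  ∏ k ∈ Finset.range m, (1 + y k / ((k : ℝ) + 1))

theorem riseProd_zero (y : ℕ → ℝ) : riseProd y 0 = 1 := by simp [riseProd]

theorem riseProd_succ (y : ℕ → ℝ) (m : ℕ) :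
    riseProd y (m + 1) = riseProd y m * (1 + y m / ((m : ℝ) + 1)) := by
  rw [riseProd, Finset.prod_range_succ, riseProd]

theorem abs_div_succ_le {x δ : ℝ} (hx : |x| ≤ δ) (k : ℕ) :
    |x / ((k : ℝ) + 1)| ≤ δ / ((k : ℝ) + 1) := by
  rw [abs_div, abs_of_pos (show (0 : ℝ) < k + 1 by positivity)]
  exact div_le_div_of_nonneg_right hx (by positivity)

theorem div_succ_le {δ : ℝ} (hδ : 0 ≤ δ) (k : ℕ) : δ / ((k : ℝ) + 1) ≤ δ :=
  div_le_self hδ (by linarith [k.cast_nonneg (α := ℝ)])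

theorem abs_div_succ_le' {x δ : ℝ} (hx : |x| ≤ δ) (k : ℕ) : |x / ((k : ℝ) + 1)| ≤ δ :=
  (abs_div_succ_le hx k).trans (div_succ_le ((abs_nonneg x).trans hx) k)

theorem riseProd_pos {y : ℕ → ℝ} {m : ℕ} (hy : ∀ k < m, |y k| ≤ 1 / 2) : 0 < riseProd y m := by
  refine Finset.prod_pos fun k hk => ?_
  have := (abs_le.mp (abs_div_succ_le' (hy k (Finset.mem_range.mp hk)) k)).1
  linarith

/-- Minus the factor, depending on the state `m`, by which the generator multiplies the product with
constant exponent `x`. -/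
noncomputable def eigen (x : ℝ) (m : ℕ) : ℝ :=
  ∑ k ∈ Finset.range m, x / (((k : ℝ) + 1) * ((k : ℝ) + 1 + x))

/-- The recursion behind `sum_riseProd_div`: the differential equation of the generating function. -/
theorem sum_riseProd_succ (x : ℝ) (m : ℕ) :
    ((m : ℝ) + 1) * ∑ j ∈ Finset.range (m + 1), riseProd (fun _ => x) j / ((m : ℝ) + 1 - j) =
      ((m : ℝ) + 1 + x) * ∑ j ∈ Finset.range m, riseProd (fun _ => x) j / ((m : ℝ) - j) +
        riseProd (fun _ => x) m := by
  set P := riseProd (fun _ => x) with hP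
  have e1 : ((m : ℝ) + 1) * ∑ j ∈ Finset.range (m + 1), P j / ((m : ℝ) + 1 - j) =
      ∑ j ∈ Finset.range (m + 1), P j +
        ∑ j ∈ Finset.range (m + 1), (j : ℝ) * P j / ((m : ℝ) + 1 - j) := by
    rw [Finset.mul_sum, ← Finset.sum_add_distrib]
    refine Finset.sum_congr rfl fun j hj => ?_
    have : (j : ℝ) < m + 1 := by exact_mod_cast Finset.mem_range.mp hj
    have : (m : ℝ) + 1 - j ≠ 0 := by linarith
    field_simp
    ring
  have e2 : ∑ j ∈ Finset.range (m + 1), (j : ℝ) * P j / ((m : ℝ) + 1 - j) =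
      ((m : ℝ) + 1 + x) * ∑ j ∈ Finset.range m, P j / ((m : ℝ) - j) -
        ∑ j ∈ Finset.range m, P j := by
    rw [Finset.sum_range_succ', Finset.mul_sum, ← Finset.sum_sub_distrib]
    simp only [Nat.cast_zero, zero_mul, zero_div, add_zero]
    refine Finset.sum_congr rfl fun j hj => ?_
    have : (j : ℝ) < m := by exact_mod_cast Finset.mem_range.mp hj
    have h1 : (m : ℝ) - j ≠ 0 := by linarith
    have h2 : (j : ℝ) + 1 ≠ 0 := by positivity
    rw [hP, riseProd_succ]
    push_cast
    rw [show (m : ℝ) + 1 - (j + 1) = m - j by ring]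
    field_simp
    ring
  rw [e1, e2, Finset.sum_range_succ]
  ring

/-- The exact action of the kernel `1 / (m - j)` on the products with constant exponent; in terms of
generating functions, this is the identity
`(1 - y)^(-1-x) * (-log (1 - y)) = d/dx (1 - y)^(-1-x)`. -/
theorem sum_riseProd_div {x : ℝ} (hx : ∀ k : ℕ, (k : ℝ) + 1 + x ≠ 0) (m : ℕ) :
    ∑ j ∈ Finset.range m, riseProd (fun _ => x) j / ((m : ℝ) - j) =
      riseProd (fun _ => x) m * ∑ k ∈ Finset.range m, 1 / ((k : ℝ) + 1 + x) := by
  induction m with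
  | zero => simp
  | succ m ih =>
    have h1 : (m : ℝ) + 1 ≠ 0 := by positivity
    have h2 := hx m
    have h3 := sum_riseProd_succ x m
    rw [ih] at h3
    apply mul_left_cancel₀ h1
    push_cast
    rw [h3, riseProd_succ, Finset.sum_range_succ]
    field_simp

theorem sum_inv_add_eq {x : ℝ} (hx : ∀ k : ℕ, (k : ℝ) + 1 + x ≠ 0) (m : ℕ) :
    ∑ k ∈ Finset.range m, 1 / ((k : ℝ) + 1 + x) = h m - eigen x m := by
  rw [h_eq_sum, eigen, ← Finset.sum_sub_distrib]
  refine Finset.sum_congr rfl fun k _ => ?_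
  have h1 : (k : ℝ) + 1 ≠ 0 := by positivity
  have h2 := hx k
  field_simp
  ring

theorem sum_ratio_sub_one {g : ℕ → ℝ} (m : ℕ) :
    ∑ j ∈ Finset.range m, (g j / g m - 1) / ((m : ℝ) - j) =
      (∑ j ∈ Finset.range m, g j / ((m : ℝ) - j)) / g m - h m := by
  rw [← sum_inv_sub, Finset.sum_div, ← Finset.sum_sub_distrib]
  exact Finset.sum_congr rfl fun j _ => by ring

theorem ne_zero_of_abs_le {x : ℝ} (hx : |x| ≤ 1 / 2) (k : ℕ) : (k : ℝ) + 1 + x ≠ 0 := by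
  have := (abs_le.mp hx).1
  have := k.cast_nonneg (α := ℝ)
  linarith

/-- The generator acts on the product with constant exponent `x` as multiplication by `-eigen x`. -/
theorem sum_riseProd_ratio {x : ℝ} (hx : |x| ≤ 1 / 2) (m : ℕ) :
    ∑ j ∈ Finset.range m, (riseProd (fun _ => x) j / riseProd (fun _ => x) m - 1) /
      ((m : ℝ) - j) = -eigen x m := by
  have hp : riseProd (fun _ => x) m ≠ 0 := (riseProd_pos fun _ _ => hx).ne'
  rw [sum_ratio_sub_one, sum_riseProd_div (ne_zero_of_abs_le hx),
    sum_inv_add_eq (ne_zero_of_abs_le hx)]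
  field_simp
  ring

theorem abs_eigen_sub_le {x : ℝ} (hx : |x| ≤ 1 / 2) (m : ℕ) :
    |eigen x m - (x * harmPow 2 m - x ^ 2 * harmPow 3 m)| ≤ 4 * |x| ^ 3 := by
  have e : eigen x m - (x * harmPow 2 m - x ^ 2 * harmPow 3 m) =
      ∑ k ∈ Finset.range m, x ^ 3 / (((k : ℝ) + 1) ^ 3 * ((k : ℝ) + 1 + x)) := by
    rw [eigen, harmPow, harmPow, Finset.mul_sum, Finset.mul_sum, ← Finset.sum_sub_distrib,
      ← Finset.sum_sub_distrib]
    refine Finset.sum_congr rfl fun k _ => ?_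
    have h1 : (k : ℝ) + 1 ≠ 0 := by positivity
    have h2 := ne_zero_of_abs_le hx k
    field_simp
    ring
  rw [e]
  calc _ ≤ ∑ k ∈ Finset.range m, |x ^ 3 / (((k : ℝ) + 1) ^ 3 * ((k : ℝ) + 1 + x))| :=
        Finset.abs_sum_le_sum_abs _ _
    _ ≤ ∑ k ∈ Finset.range m, 2 * |x| ^ 3 * (1 / ((k : ℝ) + 1) ^ 2) := by
        refine Finset.sum_le_sum fun k _ => ?_
        have hk : (0 : ℝ) ≤ k := k.cast_nonneg
        have h1 := (abs_le.mp hx).1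
        have h2 : 0 < (k : ℝ) + 1 + x := by linarith
        rw [abs_div, abs_pow, abs_of_pos (by positivity : 0 < ((k : ℝ) + 1) ^ 3 * (k + 1 + x)),
          mul_one_div, div_le_div_iff₀ (by positivity) (by positivity)]
        have h3 : ((k : ℝ) + 1) ^ 2 ≤ 2 * (((k : ℝ) + 1) ^ 3 * (k + 1 + x)) := by
          have h4 : 1 ≤ 2 * (((k : ℝ) + 1) * (k + 1 + x)) := by nlinarith
          nlinarith [sq_nonneg ((k : ℝ) + 1)]
        nlinarith [show 0 ≤ |x| ^ 3 by positivity]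
    _ = 2 * |x| ^ 3 * harmPow 2 m := by rw [harmPow, Finset.mul_sum]
    _ ≤ _ := by nlinarith [harmPow_le_two (le_refl 2) m, show 0 ≤ |x| ^ 3 by positivity]

/-! ### Comparison with approximately harmonic functions -/

/-- The minimum principle for the recursion. -/
theorem nonneg_of_recursion {u c : ℕ → ℝ} {N : ℕ} (h0 : 0 ≤ u 0)
    (hc : ∀ m, 0 < m → m ≤ N → 0 < h m - c m)
    (hu : ∀ m, 0 < m → m ≤ N →
      ∑ j ∈ Finset.range m, u j / ((m : ℝ) - j) ≤ u m * (h m - c m)) :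
    ∀ m ≤ N, 0 ≤ u m := by
  intro m
  induction m using Nat.strong_induction_on with
  | _ m ih =>
    intro hm
    rcases Nat.eq_zero_or_pos m with rfl | hpos
    · exact h0
    · have h1 : 0 ≤ ∑ j ∈ Finset.range m, u j / ((m : ℝ) - j) := by
        refine Finset.sum_nonneg fun j hj => ?_
        have hj' := Finset.mem_range.mp hj
        have : (j : ℝ) < m := by exact_mod_cast hj'
        exact div_nonneg (ih j hj' (by omega)) (by linarith)
      exact nonneg_of_mul_nonneg_left (h1.trans (hu m hpos hm)) (hc m hpos hm)

theorem le_of_supersolution {φ g c : ℕ → ℝ} {N : ℕ} (hφ0 : φ 0 = 1) (hg0 : 1 ≤ g 0)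
    (hc : ∀ m, 0 < m → m ≤ N → 0 < h m - c m)
    (hφ : ∀ m, 0 < m → m ≤ N →
      ∑ j ∈ Finset.range m, φ j / ((m : ℝ) - j) = φ m * (h m - c m))
    (hg : ∀ m, 0 < m → m ≤ N →
      ∑ j ∈ Finset.range m, g j / ((m : ℝ) - j) ≤ g m * (h m - c m)) :
    ∀ m ≤ N, φ m ≤ g m := by
  have := nonneg_of_recursion (u := fun m => g m - φ m) (by linarith) hc fun m h1 h2 => by
    simp only [sub_div, Finset.sum_sub_distrib, sub_mul]
    rw [hφ m h1 h2]
    linarith [hg m h1 h2]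
  exact fun m hm => sub_nonneg.mp (this m hm)

theorem le_of_subsolution {φ g c : ℕ → ℝ} {N : ℕ} (hφ0 : φ 0 = 1) (hg0 : g 0 ≤ 1)
    (hc : ∀ m, 0 < m → m ≤ N → 0 < h m - c m)
    (hφ : ∀ m, 0 < m → m ≤ N →
      ∑ j ∈ Finset.range m, φ j / ((m : ℝ) - j) = φ m * (h m - c m))
    (hg : ∀ m, 0 < m → m ≤ N →
      g m * (h m - c m) ≤ ∑ j ∈ Finset.range m, g j / ((m : ℝ) - j)) :
    ∀ m ≤ N, g m ≤ φ m := by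
  have := nonneg_of_recursion (u := fun m => φ m - g m) (by linarith) hc fun m h1 h2 => by
    simp only [sub_div, Finset.sum_sub_distrib, sub_mul]
    rw [hφ m h1 h2]
    linarith [hg m h1 h2]
  exact fun m hm => sub_nonneg.mp (this m hm)

theorem expMoment_recursion {z : ℝ} (hz : z < 1) (w : ℝ) {m : ℕ} (hm : 0 < m) :
    ∑ j ∈ Finset.range m, expMoment z w j / ((m : ℝ) - j) =
      expMoment z w m * ((h m - z) * Real.exp (-w)) := by
  obtain ⟨k, rfl⟩ := Nat.exists_eq_succ_of_ne_zero hm.ne'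
  have h1 : h (k + 1) - z ≠ 0 := by linarith [one_le_h hm]
  rw [Nat.succ_eq_add_one, expMoment_succ, Real.exp_neg]
  have h2 := Real.exp_ne_zero w
  push_cast
  field_simp

/-! ### Exponential moments of the jumps, and slowly varying exponents -/

/-- The jumps of the harmonic sum have a bounded exponential moment, uniformly in the state: compare
with the product with exponent `-1 / 2`. -/
theorem sum_exp_half_le (m : ℕ) :
    ∑ j ∈ Finset.range m, (Real.exp ((h m - h j) / 2) - 1) / ((m : ℝ) - j) ≤ 2 := by
  have hx : |(-(1 / 2) : ℝ)| ≤ 1 / 2 := by rw [abs_neg, abs_of_pos (by norm_num)]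
  have hpos : ∀ k, 0 < riseProd (fun _ => -(1 / 2)) k := fun k => riseProd_pos fun _ _ => hx
  have h1 : ∀ j ∈ Finset.range m, (Real.exp ((h m - h j) / 2) - 1) / ((m : ℝ) - j) ≤
      (riseProd (fun _ => -(1 / 2)) j / riseProd (fun _ => -(1 / 2)) m - 1) / ((m : ℝ) - j) := by
    intro j hj
    have hj' := Finset.mem_range.mp hj
    have : (j : ℝ) < m := by exact_mod_cast hj'
    refine div_le_div_of_nonneg_right (sub_le_sub_right ?_ 1) (by linarith)
    have h2 := le_mul_exp_h (u := riseProd (fun _ => -(1 / 2))) (c := -(1 / 2)) hj'.le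
      fun k _ _ => by
        rw [riseProd_succ]
        refine mul_le_mul_of_nonneg_left ?_ (hpos k).le
        have := Real.add_one_le_exp (-(1 / 2) * (1 / ((k : ℝ) + 1)))
        rw [mul_one_div] at this ⊢
        linarith
    rw [le_div_iff₀ (hpos m)]
    calc _ ≤ Real.exp ((h m - h j) / 2) * (riseProd (fun _ => -(1 / 2)) j *
            Real.exp (-(1 / 2) * (h m - h j))) :=
          mul_le_mul_of_nonneg_left h2 (Real.exp_nonneg _)
      _ = riseProd (fun _ => -(1 / 2)) j := by
          rw [mul_left_comm, ← Real.exp_add,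
            show (h m - h j) / 2 + -(1 / 2) * (h m - h j) = 0 by ring, Real.exp_zero, mul_one]
  refine (Finset.sum_le_sum h1).trans ?_
  rw [sum_riseProd_ratio hx, eigen, ← Finset.sum_neg_distrib]
  refine le_trans (Finset.sum_le_sum fun k _ => ?_) (harmPow_le_two (le_refl 2) m)
  have hk : (0 : ℝ) ≤ k := k.cast_nonneg
  rw [← neg_div, neg_neg, div_le_div_iff₀ (by nlinarith) (by positivity)]
  nlinarith

theorem sum_sq_mul_exp_le (m : ℕ) :
    ∑ j ∈ Finset.range m, (h m - h j) ^ 2 * Real.exp ((h m - h j) / 8) / ((m : ℝ) - j) ≤ 64 := by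
  have key : ∀ d : ℝ, 0 ≤ d → d ^ 2 * Real.exp (d / 8) ≤ 32 * (Real.exp (d / 2) - 1) := by
    intro d hd
    have h1 : d ≤ 8 * Real.exp (d / 8) := by linarith [Real.add_one_le_exp (d / 8)]
    have h2 : d / 4 ≤ Real.exp (d / 4) - 1 := by linarith [Real.add_one_le_exp (d / 4)]
    have e1 : Real.exp (d / 8) * Real.exp (d / 8) = Real.exp (d / 4) := by
      rw [← Real.exp_add]; congr 1; ring
    have e2 : Real.exp (d / 4) * Real.exp (d / 4) = Real.exp (d / 2) := by
      rw [← Real.exp_add]; congr 1; ring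
    have p1 := Real.exp_pos (d / 8)
    have p2 := Real.exp_pos (d / 4)
    calc d ^ 2 * Real.exp (d / 8) ≤ d * (8 * Real.exp (d / 8)) * Real.exp (d / 8) := by
          rw [sq]; gcongr
      _ = 32 * (d / 4 * Real.exp (d / 4)) := by rw [← e1]; ring
      _ ≤ 32 * ((Real.exp (d / 4) - 1) * (Real.exp (d / 4) + 1)) := by
          have : 0 ≤ d / 4 := by positivity
          gcongr <;> linarith
      _ = _ := by rw [← e2]; ring
  calc _ ≤ ∑ j ∈ Finset.range m, 32 * ((Real.exp ((h m - h j) / 2) - 1) / ((m : ℝ) - j)) := by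
        refine Finset.sum_le_sum fun j hj => ?_
        have hj' := Finset.mem_range.mp hj
        have : (j : ℝ) < m := by exact_mod_cast hj'
        rw [← mul_div_assoc]
        exact div_le_div_of_nonneg_right (key _ (sub_nonneg.mpr (h_mono hj'.le))) (by linarith)
    _ ≤ _ := by rw [← Finset.mul_sum]; linarith [sum_exp_half_le m]

theorem one_add_div_le {a b : ℝ} (hb : |b| ≤ 1 / 2) :
    (1 + a) / (1 + b) ≤ Real.exp (2 * |a - b|) := by
  have h1 : 1 / 2 ≤ 1 + b := by linarith [(abs_le.mp hb).1]
  have h2 := Real.add_one_le_exp (2 * |a - b|)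
  refine le_trans ?_ h2
  rw [div_le_iff₀ (by linarith)]
  nlinarith [le_abs_self (a - b), abs_nonneg (a - b)]

/-- Two products with close exponents have slowly varying ratio. -/
theorem riseProd_div_le {a b : ℕ → ℝ} {D : ℝ} {j m : ℕ} (hjm : j ≤ m)
    (ha : ∀ k < m, |a k| ≤ 1 / 2) (hb : ∀ k < m, |b k| ≤ 1 / 2)
    (hab : ∀ k, j ≤ k → k < m → |a k - b k| ≤ D) :
    riseProd a m / riseProd b m ≤
      riseProd a j / riseProd b j * Real.exp (2 * D * (h m - h j)) := by
  refine le_mul_exp_h (u := fun k => riseProd a k / riseProd b k) hjm fun k hjk hkm => ?_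
  have p1 : 0 < riseProd a k := riseProd_pos fun i hi => ha i (hi.trans hkm)
  have p2 : 0 < riseProd b k := riseProd_pos fun i hi => hb i (hi.trans hkm)
  simp only [riseProd_succ]
  rw [mul_div_mul_comm]
  refine mul_le_mul_of_nonneg_left ?_ (by positivity)
  refine (one_add_div_le (abs_div_succ_le' (hb k hkm) k)).trans (Real.exp_le_exp.mpr ?_)
  have h1 := abs_div_succ_le (hab k hjk hkm) k
  rw [sub_div] at h1
  calc _ ≤ 2 * (D / ((k : ℝ) + 1)) := by linarith
    _ = _ := by ring

theorem riseProd_const_ratio_le {x δ : ℝ} (hx : |x| ≤ δ) (hδ : δ ≤ 1 / 2) {j m : ℕ} (hjm : j ≤ m) :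
    riseProd (fun _ => x) j / riseProd (fun _ => x) m ≤ Real.exp (2 * δ * (h m - h j)) := by
  have hpos : ∀ k, 0 < riseProd (fun _ => x) k := fun k => riseProd_pos fun _ _ => hx.trans hδ
  have h1 := riseProd_div_le (a := fun _ => 0) (b := fun _ => x) (D := δ) hjm (by simp)
    (fun _ _ => hx.trans hδ) (by simpa using fun _ _ _ => hx)
  have e0 : ∀ k, riseProd (fun _ => 0) k = 1 := fun k => by simp [riseProd]
  rw [e0, e0, div_mul_eq_mul_div, one_mul, div_le_div_iff₀ (hpos m) (hpos j), one_mul] at h1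
  rwa [div_le_iff₀ (hpos m)]

/-- For a slowly varying exponent `y`, the generator acts on the product approximately as it does
for the constant exponent given by the value of `y` at the current state. -/
theorem abs_sum_riseProd_ratio_add_eigen_le {y : ℕ → ℝ} {x B δ : ℝ} {m : ℕ} (hδ : δ ≤ 1 / 32)
    (hx : |x| ≤ δ) (hy : ∀ k < m, |y k| ≤ δ) (hB : 0 ≤ B) (hBm : B * h m ≤ δ)
    (hxy : ∀ k < m, |x - y k| ≤ B * (h m - h k)) :
    |∑ j ∈ Finset.range m, (riseProd y j / riseProd y m - 1) / ((m : ℝ) - j) + eigen x m| ≤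
      128 * B := by
  have hx2 : |x| ≤ 1 / 2 := by linarith
  have hy2 : ∀ k < m, |y k| ≤ 1 / 2 := fun k hk => by linarith [hy k hk]
  have hP : ∀ k, 0 < riseProd (fun _ => x) k := fun k => riseProd_pos fun _ _ => hx2
  have e : ∑ j ∈ Finset.range m, (riseProd y j / riseProd y m - 1) / ((m : ℝ) - j) + eigen x m =
      ∑ j ∈ Finset.range m, (riseProd y j / riseProd y m -
        riseProd (fun _ => x) j / riseProd (fun _ => x) m) / ((m : ℝ) - j) := by
    rw [← neg_neg (eigen x m), ← sum_riseProd_ratio hx2, ← sub_eq_add_neg,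
      ← Finset.sum_sub_distrib]
    exact Finset.sum_congr rfl fun j _ => by ring
  rw [e]
  calc _ ≤ ∑ j ∈ Finset.range m, |(riseProd y j / riseProd y m -
        riseProd (fun _ => x) j / riseProd (fun _ => x) m) / ((m : ℝ) - j)| :=
        Finset.abs_sum_le_sum_abs _ _
    _ ≤ ∑ j ∈ Finset.range m, 2 * B *
        ((h m - h j) ^ 2 * Real.exp ((h m - h j) / 8) / ((m : ℝ) - j)) := by
      refine Finset.sum_le_sum fun j hj => ?_
      have hjm := Finset.mem_range.mp hj
      have hjr : (j : ℝ) < m := by exact_mod_cast hjm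
      set d := h m - h j with hd
      have hd0 : 0 ≤ d := sub_nonneg.mpr (h_mono hjm.le)
      have hdm : d ≤ h m := by linarith [h_nonneg j]
      have pm : 0 < riseProd y m := riseProd_pos hy2
      have pj : 0 < riseProd y j := riseProd_pos fun k hk => hy2 k (hk.trans hjm)
      have Pm := hP m
      have Pj := hP j
      have hD : ∀ k, j ≤ k → k < m → |x - y k| ≤ B * d := fun k h1 h2 =>
        (hxy k h2).trans (mul_le_mul_of_nonneg_left (by linarith [h_mono h1]) hB)
      have r1 := riseProd_div_le (a := fun _ => x) (b := y) hjm.le (fun _ _ => hx2) hy2 hD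
      have r2 := riseProd_div_le (a := y) (b := fun _ => x) hjm.le hy2 (fun _ _ => hx2)
        fun k h1 h2 => by rw [abs_sub_comm]; exact hD k h1 h2
      set Y := 2 * (B * d) * d with hY
      have hY0 : 0 ≤ Y := by positivity
      have hYd : Y ≤ 2 * δ * d := by
        have : B * d ≤ δ := (mul_le_mul_of_nonneg_left hdm hB).trans hBm
        nlinarith
      set R := riseProd (fun _ => x) j / riseProd (fun _ => x) m with hR
      have hR0 : 0 < R := div_pos Pj Pm
      have hRle : R ≤ Real.exp (2 * δ * d) := riseProd_const_ratio_le hx (by linarith) hjm.le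
      have up : riseProd y j / riseProd y m ≤ R * Real.exp Y := by
        rw [hR, div_mul_eq_mul_div, div_le_div_iff₀ pm Pm]
        rw [div_mul_eq_mul_div, div_le_div_iff₀ pm pj] at r1
        linarith
      have lo : R ≤ riseProd y j / riseProd y m * Real.exp Y := by
        rw [hR, div_mul_eq_mul_div, div_le_div_iff₀ Pm pm]
        rw [div_mul_eq_mul_div, div_le_div_iff₀ Pm Pj] at r2
        linarith
      have hexp : Real.exp Y - 1 ≤ Y * Real.exp Y := by
        have h1 : 1 - Y ≤ Real.exp (-Y) := by linarith [Real.add_one_le_exp (-Y)]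
        have h2 : Real.exp (-Y) * Real.exp Y = 1 := by rw [← Real.exp_add]; simp
        nlinarith [Real.exp_pos Y]
      have hE1 : 1 ≤ Real.exp Y := Real.one_le_exp hY0
      have hab : |riseProd y j / riseProd y m - R| ≤ R * (Real.exp Y - 1) := by
        set ρ := riseProd y j / riseProd y m
        have hρ : 0 < ρ := div_pos pj pm
        rw [abs_le]
        constructor
        · by_contra! hcon
          -- `R ≤ ρ e^Y` and `e^Y + e^(-Y) ≥ 2`
          have h1 : ρ * Real.exp Y < R * (2 - Real.exp Y) * Real.exp Y :=
            mul_lt_mul_of_pos_right (by linarith) (by linarith)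
          nlinarith [sq_nonneg (Real.exp Y - 1)]
        · linarith
      rw [abs_div, abs_of_pos (by linarith : 0 < (m : ℝ) - j), ← mul_div_assoc]
      refine div_le_div_of_nonneg_right ?_ (by linarith)
      calc _ ≤ R * (Real.exp Y - 1) := hab
        _ ≤ R * (Y * Real.exp Y) := mul_le_mul_of_nonneg_left hexp hR0.le
        _ ≤ Real.exp (2 * δ * d) * (Y * Real.exp (2 * δ * d)) := by gcongr
        _ = 2 * B * (d ^ 2 * Real.exp (4 * δ * d)) := by
          rw [mul_left_comm, ← Real.exp_add, hY]; ring_nf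
        _ ≤ 2 * B * (d ^ 2 * Real.exp (d / 8)) := by
          gcongr
          nlinarith
    _ ≤ _ := by rw [← Finset.mul_sum]; nlinarith [sum_sq_mul_exp_le m]

/-! ### Size of the products -/

theorem riseProd_le_exp {y : ℕ → ℝ} {m : ℕ} (hy : ∀ k < m, |y k| ≤ 1 / 2) :
    riseProd y m ≤ Real.exp (∑ k ∈ Finset.range m, y k / ((k : ℝ) + 1)) := by
  rw [Real.exp_sum]
  refine Finset.prod_le_prod (fun k hk => ?_) fun k _ => ?_
  · have := (abs_le.mp (abs_div_succ_le' (hy k (Finset.mem_range.mp hk)) k)).1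
    linarith
  · linarith [Real.add_one_le_exp (y k / ((k : ℝ) + 1))]

theorem exp_sub_sq_le {t : ℝ} (ht : |t| ≤ 1 / 8) : Real.exp (t - 2 * t ^ 2) ≤ 1 + t := by
  obtain ⟨h1, h2⟩ := abs_le.mp ht
  have h3 : |t - 2 * t ^ 2| ≤ 1 := by rw [abs_le]; constructor <;> nlinarith
  have h4 := (abs_le.mp (Real.abs_exp_sub_one_sub_id_le h3)).2
  have h5 : (t - 2 * t ^ 2) ^ 2 ≤ 2 * t ^ 2 := by
    have : (1 - 2 * t) ^ 2 ≤ 2 := by nlinarith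
    nlinarith [sq_nonneg t]
  linarith

theorem exp_le_riseProd {y : ℕ → ℝ} {m : ℕ} {τ : ℝ} (hτ : τ ≤ 1 / 8) (hy : ∀ k < m, |y k| ≤ τ) :
    Real.exp (∑ k ∈ Finset.range m, y k / ((k : ℝ) + 1) - 4 * τ ^ 2) ≤ riseProd y m := by
  have h1 : ∑ k ∈ Finset.range m, 2 * (y k / ((k : ℝ) + 1)) ^ 2 ≤ 4 * τ ^ 2 := by
    calc _ ≤ ∑ k ∈ Finset.range m, 2 * τ ^ 2 * (1 / ((k : ℝ) + 1) ^ 2) := by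
          refine Finset.sum_le_sum fun k hk => ?_
          have h2 := hy k (Finset.mem_range.mp hk)
          have h3 : y k ^ 2 ≤ τ ^ 2 := sq_le_sq' (abs_le.mp h2).1 (abs_le.mp h2).2
          rw [div_pow, mul_one_div, ← mul_div_assoc]
          gcongr
      _ = 2 * τ ^ 2 * harmPow 2 m := by rw [harmPow, Finset.mul_sum]
      _ ≤ _ := by nlinarith [harmPow_le_two (le_refl 2) m, sq_nonneg τ]
  calc _ ≤ Real.exp (∑ k ∈ Finset.range m,
        (y k / ((k : ℝ) + 1) - 2 * (y k / ((k : ℝ) + 1)) ^ 2)) := by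
        rw [Finset.sum_sub_distrib]
        exact Real.exp_le_exp.mpr (by linarith)
    _ ≤ _ := by
        rw [Real.exp_sum]
        refine Finset.prod_le_prod (fun k _ => (Real.exp_pos _).le) fun k hk => ?_
        exact exp_sub_sq_le ((abs_div_succ_le' (hy k (Finset.mem_range.mp hk)) k).trans hτ)

theorem sum_const_div (x : ℝ) (m : ℕ) :
    ∑ k ∈ Finset.range m, x / ((k : ℝ) + 1) = x * h m := by
  rw [h_eq_sum, Finset.mul_sum]
  exact Finset.sum_congr rfl fun k _ => by ring

/-! ### Exponential moments of the time-height -/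

theorem riseProd_sub_one_mul (x : ℝ) (m : ℕ) :
    riseProd (fun _ => x - 1) m * ((m : ℝ) + x) = x * riseProd (fun _ => x) m := by
  induction m with
  | zero => simp [riseProd_zero]
  | succ m ih =>
    have h1 : (m : ℝ) + 1 ≠ 0 := by positivity
    rw [riseProd_succ, riseProd_succ]
    push_cast
    have e : riseProd (fun _ => x - 1) m * (1 + (x - 1) / ((m : ℝ) + 1)) * ((m : ℝ) + 1 + x) =
        riseProd (fun _ => x - 1) m * ((m : ℝ) + x) * (((m : ℝ) + 1 + x) / (m + 1)) := by
      field_simp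
      ring
    rw [e, ih]
    field_simp

theorem natCast_add_ne_zero {x : ℝ} (hx0 : x ≠ 0) (hx : |x| ≤ 1 / 2) (k : ℕ) :
    (k : ℝ) + x ≠ 0 := by
  cases k with
  | zero => simpa using hx0
  | succ k => push_cast; exact ne_zero_of_abs_le hx k

theorem sum_inv_add_shift (x : ℝ) (m : ℕ) :
    ∑ k ∈ Finset.range m, 1 / ((k : ℝ) + 1 + (x - 1)) =
      1 / x + ∑ k ∈ Finset.range m, 1 / ((k : ℝ) + 1 + x) - 1 / ((m : ℝ) + x) := by
  induction m with
  | zero => simp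
  | succ m ih =>
    rw [Finset.sum_range_succ, Finset.sum_range_succ, ih]
    push_cast
    rw [show (m : ℝ) + 1 + (x - 1) = m + x by ring]
    ring

/-- The combination of the products with exponents `x` and `x - 1` is almost harmonic for the
generator with potential `z`. The second product is smaller by a factor of order `x / m`, and corrects
the discretization error of the first one. -/
theorem residual_combination {x : ℝ} (hx0 : x ≠ 0) (hx : |x| ≤ 1 / 2) (c z : ℝ) (m : ℕ) :
    ∑ j ∈ Finset.range m, ((1 + c) * riseProd (fun _ => x) j - c * riseProd (fun _ => x - 1) j) /
        ((m : ℝ) - j) -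
      ((1 + c) * riseProd (fun _ => x) m - c * riseProd (fun _ => x - 1) m) * (h m - z) =
    riseProd (fun _ => x) m * ((1 + c) * (z - eigen x m) -
      c / ((m : ℝ) + x) * (1 + x * (z - eigen x m - 1 / ((m : ℝ) + x)))) := by
  have hk := natCast_add_ne_zero hx0 hx
  have hmx := hk m
  have e1 : ∑ j ∈ Finset.range m,
      ((1 + c) * riseProd (fun _ => x) j - c * riseProd (fun _ => x - 1) j) / ((m : ℝ) - j) =
      (1 + c) * ∑ j ∈ Finset.range m, riseProd (fun _ => x) j / ((m : ℝ) - j) -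
        c * ∑ j ∈ Finset.range m, riseProd (fun _ => x - 1) j / ((m : ℝ) - j) := by
    rw [Finset.mul_sum, Finset.mul_sum, ← Finset.sum_sub_distrib]
    exact Finset.sum_congr rfl fun j _ => by ring
  have hQ : riseProd (fun _ => x - 1) m = x * riseProd (fun _ => x) m / ((m : ℝ) + x) := by
    rw [eq_div_iff hmx, riseProd_sub_one_mul]
  rw [e1, sum_riseProd_div (ne_zero_of_abs_le hx),
    sum_riseProd_div (x := x - 1) (fun k => by
      rw [show (k : ℝ) + 1 + (x - 1) = k + x by ring]; exact hk k),
    sum_inv_add_shift, sum_inv_add_eq (ne_zero_of_abs_le hx), hQ]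
  field_simp
  ring

/-- The residual of the product with shifted exponent `x + η`, up to the leading effect
`η * harmPow 2 m` of the shift: a discretization error of order `x / m`, which
`residual_combination` corrects, and a Taylor error of order `x ^ 3`, which the shift absorbs. -/
theorem abs_time_residual_le {x η : ℝ} (hx : |x| ≤ 1 / 100) (hη : |η| ≤ 10 * |x| ^ 3) (m : ℕ) :
    |zetaReal 2 * x - zetaReal 3 * x ^ 2 - eigen (x + η) m + η * harmPow 2 m| ≤
      3 * |x| / ((m : ℝ) + 1) + 8 * |x| ^ 3 := by
  set t := |x| with ht
  have ht0 : 0 ≤ t := abs_nonneg x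
  have hη' : |η| ≤ t / 1000 := by
    have : t ^ 3 ≤ t / 10000 := by nlinarith [mul_nonneg ht0 ht0]
    linarith
  have hx' : |x + η| ≤ t * (1001 / 1000) := (abs_add_le x η).trans (by linarith)
  have b1 := abs_eigen_sub_le (x := x + η) (by linarith) m
  have b1' : 4 * |x + η| ^ 3 ≤ 5 * t ^ 3 := by
    have := pow_le_pow_left₀ (abs_nonneg _) hx' 3
    nlinarith [pow_nonneg ht0 3]
  set H2 := harmPow 2 m
  set H3 := harmPow 3 m
  have i0 : 0 ≤ 2 / ((m : ℝ) + 1) := by positivity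
  have b2 : |x * (zetaReal 2 - H2)| ≤ t * (2 / ((m : ℝ) + 1)) := by
    rw [abs_mul]
    refine mul_le_mul_of_nonneg_left ?_ ht0
    rw [abs_of_nonneg (by linarith [harmPow_le_zetaReal (le_refl 2) m])]
    linarith [zetaReal_le (le_refl 2) m]
  have b3 : |x ^ 2 * (zetaReal 3 - H3)| ≤ t / 100 * (2 / ((m : ℝ) + 1)) := by
    rw [abs_mul, abs_pow]
    refine mul_le_mul (by nlinarith) ?_ (abs_nonneg _) (by positivity)
    rw [abs_of_nonneg (by linarith [harmPow_le_zetaReal (show 2 ≤ 3 by norm_num) m])]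
    linarith [zetaReal_le (show 2 ≤ 3 by norm_num) m]
  have b4 : |η * (2 * x + η) * H3| ≤ t ^ 3 := by
    have h3 : |H3| ≤ 2 := by
      rw [abs_of_nonneg]
      · exact harmPow_le_two (by norm_num) m
      · exact Finset.sum_nonneg fun k _ => by positivity
    have h4 : |2 * x + η| ≤ 21 / 1000 := by
      refine (abs_add_le _ _).trans ?_
      rw [abs_mul, abs_two]
      linarith
    rw [abs_mul, abs_mul]
    calc |η| * |2 * x + η| * |H3| ≤ 10 * t ^ 3 * (21 / 1000) * 2 := by gcongr
      _ ≤ t ^ 3 := by linarith [pow_nonneg ht0 3]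
  have e : 3 * t / ((m : ℝ) + 1) = 3 / 2 * t * (2 / ((m : ℝ) + 1)) := by ring
  have i1 : 0 ≤ t * (2 / ((m : ℝ) + 1)) := by positivity
  rw [e]
  rw [abs_le] at b1 b2 b3 b4 ⊢
  constructor <;> nlinarith [pow_nonneg ht0 3]

/-- Sharp two-sided bounds for the exponential moments of the time-height. The numbers `10` and `12`
in the proof are large enough for the shift of the exponent and the multiple of the second product
to dominate the error terms of `abs_time_residual_le`. -/
theorem exp_time_bounds {x : ℝ} (hx0 : x ≠ 0) (hx : |x| ≤ 1 / 100) (m : ℕ) :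
    expMoment (zetaReal 2 * x - zetaReal 3 * x ^ 2) 0 m ≤
        (1 + 24 * |x|) * Real.exp ((x + 10 * |x| ^ 3) * h m) ∧
      (1 - 24 * |x|) * Real.exp ((x - 10 * |x| ^ 3) * h m - 16 * |x| ^ 2) ≤
        expMoment (zetaReal 2 * x - zetaReal 3 * x ^ 2) 0 m := by
  set z := zetaReal 2 * x - zetaReal 3 * x ^ 2 with hz
  set t := |x| with ht
  have ht0 : 0 < t := abs_pos.mpr hx0
  have ht3 : 10 * t ^ 3 ≤ t / 1000 := by nlinarith [mul_pos ht0 ht0]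
  have hz1 : z < 1 := by
    have h1 : zetaReal 2 * x ≤ 2 * t := by
      have := le_abs_self x
      nlinarith [zetaReal_le_two (le_refl 2), one_le_zetaReal (le_refl 2)]
    have h2 : 0 ≤ zetaReal 3 * x ^ 2 :=
      mul_nonneg (by linarith [one_le_zetaReal (show 2 ≤ 3 by norm_num)]) (sq_nonneg x)
    linarith
  have hc : ∀ k, 0 < k → k ≤ m → 0 < h k - z := fun k hk _ => by linarith [one_le_h hk]
  have hφ : ∀ k, 0 < k → k ≤ m → ∑ j ∈ Finset.range k, expMoment z 0 j / ((k : ℝ) - j) =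
      expMoment z 0 k * (h k - z) := fun k hk _ => by
    rw [expMoment_recursion hz1 0 hk]; simp
  -- estimates common to both signs of the shift `η` of the exponent
  have main : ∀ η : ℝ, |η| = 10 * t ^ 3 → x + η ≠ 0 ∧ |x + η| ≤ 2 * t ∧ |x + η| ≤ 1 / 50 ∧
      ∀ k : ℕ, 0 < k → 0 < (k : ℝ) + (x + η) ∧
        6 * t / ((k : ℝ) + 1) ≤ 12 * t / ((k : ℝ) + (x + η)) *
          (1 + (x + η) * (z - eigen (x + η) k - 1 / ((k : ℝ) + (x + η)))) ∧
        |riseProd (fun _ => x + η - 1) k| ≤ riseProd (fun _ => x + η) k := by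
    intro η hη
    have h1 : |x + η| ≤ 2 * t := (abs_add_le _ _).trans (by linarith)
    have h2 : |x + η| ≤ 1 / 50 := h1.trans (by linarith)
    have h0 : x + η ≠ 0 := by
      intro h0
      have : t = |η| := by rw [ht, ← abs_neg η]; congr 1; linarith
      linarith
    refine ⟨h0, h1, h2, fun k hk => ?_⟩
    obtain ⟨l1, l2⟩ := abs_le.mp h2
    have hk1 : (1 : ℝ) ≤ k := by exact_mod_cast hk
    have hpos : 0 < (k : ℝ) + (x + η) := by linarith
    refine ⟨hpos, ?_, ?_⟩
    · have b := abs_time_residual_le hx hη.le k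
      have b3 : 3 * |x| / ((k : ℝ) + 1) ≤ 3 / 100 :=
        (div_le_self (by positivity) (by linarith)).trans (by linarith)
      have b4 : |η * harmPow 2 k| ≤ 1 / 100 := by
        rw [abs_mul, abs_of_nonneg (by linarith [one_le_harmPow 2 hk] : 0 ≤ harmPow 2 k), hη]
        nlinarith [harmPow_le_two (le_refl 2) k, one_le_harmPow 2 hk]
      have b5 : |z - eigen (x + η) k| ≤ 1 := by
        rw [abs_le] at b b4 ⊢
        constructor <;> linarith
      have b6 : |1 / ((k : ℝ) + (x + η))| ≤ 2 := by
        rw [abs_of_pos (by positivity), div_le_iff₀ hpos]; linarith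
      have b7 : |(x + η) * (z - eigen (x + η) k - 1 / ((k : ℝ) + (x + η)))| ≤ 1 / 2 := by
        rw [abs_mul]
        have := (abs_sub (z - eigen (x + η) k) (1 / ((k : ℝ) + (x + η))))
        calc _ ≤ 1 / 50 * 3 := mul_le_mul h2 (by linarith) (abs_nonneg _) (by norm_num)
          _ ≤ _ := by norm_num
      have b8 := (abs_le.mp b7).1
      calc 6 * t / ((k : ℝ) + 1) ≤ 6 * t / ((k : ℝ) + (x + η)) :=
            div_le_div_of_nonneg_left (by positivity) hpos (by linarith)
        _ = 12 * t / ((k : ℝ) + (x + η)) * (1 / 2) := by ring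
        _ ≤ _ := mul_le_mul_of_nonneg_left (by linarith) (by positivity)
    · have hp : 0 < riseProd (fun _ => x + η) k := riseProd_pos fun _ _ => by linarith
      have hQ := riseProd_sub_one_mul (x + η) k
      have hQ' : |riseProd (fun _ => x + η - 1) k| * ((k : ℝ) + (x + η)) =
          |x + η| * riseProd (fun _ => x + η) k := by
        have := congrArg abs hQ
        rwa [abs_mul, abs_mul, abs_of_pos hpos, abs_of_pos hp] at this
      nlinarith [abs_nonneg (riseProd (fun _ => x + η - 1) k)]
  constructor
  · obtain ⟨h0, h1, h2, h3⟩ := main (10 * t ^ 3) (abs_of_nonneg (by positivity))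
    set x' := x + 10 * t ^ 3 with hx'
    have hp : ∀ k, 0 < riseProd (fun _ => x') k := fun k => riseProd_pos fun _ _ => by linarith
    have key := le_of_supersolution (φ := expMoment z 0) (c := fun _ => z) (N := m)
      (g := fun k => (1 + 12 * t) * riseProd (fun _ => x') k - 12 * t * riseProd (fun _ => x' - 1) k)
      (expMoment_zero _ _) (by simp [riseProd_zero]) hc hφ (fun k hk _ => by
        rw [← sub_nonpos, residual_combination h0 (by linarith)]
        refine mul_nonpos_of_nonneg_of_nonpos (hp k).le ?_
        obtain ⟨q1, q2, q3⟩ := h3 k hk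
        have b := (abs_le.mp (abs_time_residual_le hx
          (η := 10 * t ^ 3) (abs_of_nonneg (by positivity)).le k)).2
        have hH := one_le_harmPow 2 hk
        have he : z - eigen x' k ≤ 3 * t / ((k : ℝ) + 1) := by
          have : 0 ≤ t ^ 3 := by positivity
          nlinarith
        have h6 : 0 ≤ 3 * t / ((k : ℝ) + 1) := by positivity
        have e6 : 6 * t / ((k : ℝ) + 1) = 2 * (3 * t / ((k : ℝ) + 1)) := by ring
        rw [e6] at q2
        nlinarith) m le_rfl
    refine key.trans ?_
    have hle : (1 + 12 * t) * riseProd (fun _ => x') m - 12 * t * riseProd (fun _ => x' - 1) m ≤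
        (1 + 24 * t) * riseProd (fun _ => x') m := by
      rcases Nat.eq_zero_or_pos m with rfl | hm
      · simp only [riseProd_zero]; linarith
      · have := (abs_le.mp (h3 m hm).2.2).1
        nlinarith
    refine hle.trans (mul_le_mul_of_nonneg_left ?_ (by positivity))
    refine (riseProd_le_exp fun _ _ => by linarith).trans (le_of_eq ?_)
    rw [sum_const_div]
  · obtain ⟨h0, h1, h2, h3⟩ := main (-(10 * t ^ 3))
      (by rw [abs_neg]; exact abs_of_nonneg (by positivity))
    set x' := x + -(10 * t ^ 3) with hx'
    have hp : ∀ k, 0 < riseProd (fun _ => x') k := fun k => riseProd_pos fun _ _ => by linarith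
    have key := le_of_subsolution (φ := expMoment z 0) (c := fun _ => z) (N := m)
      (g := fun k => (1 + -(12 * t)) * riseProd (fun _ => x') k -
        -(12 * t) * riseProd (fun _ => x' - 1) k)
      (expMoment_zero _ _) (by simp [riseProd_zero]) hc hφ (fun k hk _ => by
        rw [← sub_nonneg, residual_combination h0 (by linarith)]
        refine mul_nonneg (hp k).le ?_
        obtain ⟨q1, q2, q3⟩ := h3 k hk
        have b := (abs_le.mp (abs_time_residual_le hx
          (η := -(10 * t ^ 3)) (by rw [abs_neg]; exact (abs_of_nonneg (by positivity)).le) k)).1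
        have hH := one_le_harmPow 2 hk
        have he : -(3 * t / ((k : ℝ) + 1)) ≤ z - eigen x' k := by
          have : 0 ≤ t ^ 3 := by positivity
          nlinarith
        have h6 : 0 ≤ 3 * t / ((k : ℝ) + 1) := by positivity
        have e6 : 6 * t / ((k : ℝ) + 1) = 2 * (3 * t / ((k : ℝ) + 1)) := by ring
        rw [e6] at q2
        rw [neg_div, neg_mul]
        nlinarith) m le_rfl
    refine le_trans ?_ key
    have hle : (1 - 24 * t) * riseProd (fun _ => x') m ≤
        (1 + -(12 * t)) * riseProd (fun _ => x') m - -(12 * t) * riseProd (fun _ => x' - 1) m := by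
      rcases Nat.eq_zero_or_pos m with rfl | hm
      · simp only [riseProd_zero]; linarith
      · have := (abs_le.mp (h3 m hm).2.2).1
        nlinarith
    refine le_trans (mul_le_mul_of_nonneg_left ?_ (by linarith)) hle
    refine le_trans (le_of_eq ?_) (exp_le_riseProd (τ := 2 * t) (by linarith) fun _ _ => h1)
    rw [sum_const_div, hx']
    congr 1
    ring

/-! ### Exponential moments of the edge-height -/

/-- The local exponent used for the edge-height: the second-order solution `x`, up to a shift `η`,
of `ζ(2) x - ζ(3) x ^ 2 = w y` with `y` the current harmonic number. -/
noncomputable def edgeExponent (w η y : ℝ) : ℝ :=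
  w * y / zetaReal 2 + zetaReal 3 / zetaReal 2 ^ 3 * (w * y) ^ 2 + η

theorem zeta_ratio_mem : 0 < zetaReal 3 / zetaReal 2 ^ 3 ∧ zetaReal 3 / zetaReal 2 ^ 3 ≤ 2 := by
  have h2 := one_le_zetaReal (le_refl 2)
  have h3 := one_le_zetaReal (show 2 ≤ 3 by norm_num)
  have h3' := zetaReal_le_two (show 2 ≤ 3 by norm_num)
  have h4 : 1 ≤ zetaReal 2 ^ 3 := one_le_pow₀ h2
  refine ⟨by positivity, ?_⟩
  exact (div_le_self (by linarith) h4).trans h3'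

theorem abs_div_zeta_le (a : ℝ) : |a / zetaReal 2| ≤ |a| := by
  have h2 := one_le_zetaReal (le_refl 2)
  rw [abs_div, abs_of_pos (by linarith : 0 < zetaReal 2)]
  exact div_le_self (abs_nonneg a) h2

theorem abs_edgeExponent_le {w η y δ : ℝ} (hδ : δ ≤ 1 / 100) (hwy : |w * y| ≤ δ) (hη : |η| ≤ δ) :
    |edgeExponent w η y| ≤ 3 * δ := by
  have h1 := (abs_div_zeta_le (w * y)).trans hwy
  obtain ⟨c0, c2⟩ := zeta_ratio_mem
  have h3 : |zetaReal 3 / zetaReal 2 ^ 3 * (w * y) ^ 2| ≤ δ := by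
    rw [abs_mul, abs_pow, abs_of_pos c0]
    have : |w * y| ^ 2 ≤ δ * (1 / 100) := by
      rw [sq]; exact mul_le_mul hwy (hwy.trans hδ) (abs_nonneg _) ((abs_nonneg _).trans hwy)
    nlinarith [sq_nonneg |w * y|, abs_nonneg (w * y)]
  exact (abs_add_three _ _ _).trans (by linarith)

theorem abs_edgeExponent_sub_le {w η y y' : ℝ} (hy : |w * y| ≤ 1 / 100) (hy' : |w * y'| ≤ 1 / 100) :
    |edgeExponent w η y - edgeExponent w η y'| ≤ 2 * |w| * |y - y'| := by
  obtain ⟨c0, c2⟩ := zeta_ratio_mem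
  have e : edgeExponent w η y - edgeExponent w η y' = w * (y - y') / zetaReal 2 +
      zetaReal 3 / zetaReal 2 ^ 3 * (w * y + w * y') * (w * (y - y')) := by
    unfold edgeExponent; ring
  have h1 := abs_div_zeta_le (w * (y - y'))
  have h2 : |zetaReal 3 / zetaReal 2 ^ 3 * (w * y + w * y')| ≤ 1 := by
    rw [abs_mul, abs_of_pos c0]
    have := abs_add_le (w * y) (w * y')
    nlinarith [abs_nonneg (w * y + w * y')]
  rw [e]
  refine (abs_add_le _ _).trans ?_
  rw [abs_mul (_ * _) (w * (y - y'))]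
  have h3 : |w * (y - y')| = |w| * |y - y'| := abs_mul _ _
  rw [h3] at h1 ⊢
  nlinarith [mul_nonneg (abs_nonneg w) (abs_nonneg (y - y'))]

/-- The frozen exponent solves its defining equation up to terms of order `w` and `δ ^ 3`, and the
effect of the shift. Both are negligible against `1 / h m` when `w` is of order `h m ^ (-3/2)`, so that
no correction for small states is needed. -/
theorem abs_edge_residual_le {w η δ : ℝ} {m : ℕ} (hδ : δ ≤ 1 / 100) (hw : |w * h m| ≤ δ)
    (hη : |η| ≤ δ) :
    |w * h m - eigen (edgeExponent w η (h m)) m + η * harmPow 2 m| ≤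
      8 * |w| + 124 * δ ^ 3 + 8 * δ * |η| := by
  have hδ0 : 0 ≤ δ := (abs_nonneg _).trans hη
  have hx := abs_edgeExponent_le hδ hw hη
  have b1 := abs_eigen_sub_le (x := edgeExponent w η (h m)) (by linarith) m
  have b1' : 4 * |edgeExponent w η (h m)| ^ 3 ≤ 108 * δ ^ 3 := by
    have := pow_le_pow_left₀ (abs_nonneg _) hx 3
    nlinarith
  set x := edgeExponent w η (h m) with hxdef
  set s := w * h m with hs
  set H2 := harmPow 2 m
  set H3 := harmPow 3 m
  have z2 := one_le_zetaReal (le_refl 2)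
  have z3 := one_le_zetaReal (show 2 ≤ 3 by norm_num)
  have z3' := zetaReal_le_two (show 2 ≤ 3 by norm_num)
  have D2 := harmPow_le_zetaReal (le_refl 2) m
  have D3 := harmPow_le_zetaReal (show 2 ≤ 3 by norm_num) m
  have D2' := zetaReal_le (le_refl 2) m
  have D3' := zetaReal_le (show 2 ≤ 3 by norm_num) m
  set i := 1 / zetaReal 2 with hi
  have hi1 : zetaReal 2 * i = 1 := by rw [hi]; field_simp
  have hi0 : 0 < i := by positivity
  have hile : i ≤ 1 := by rw [hi, div_le_one (by linarith)]; exact z2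
  set β := zetaReal 3 * i ^ 3 * s ^ 2 + η with hβ
  have hxe : x = s * i + β := by
    rw [hxdef, edgeExponent, hβ, hi]; field_simp
    ring
  have e : s - (x * H2 - x ^ 2 * H3) + η * H2 = s * i * (zetaReal 2 - H2) +
      s ^ 2 * i ^ 2 * (zetaReal 3 * i * (zetaReal 2 - H2) - (zetaReal 3 - H3)) +
      β * (2 * (s * i) + β) * H3 := by
    rw [hxe, hβ]
    linear_combination (-s - s ^ 2 * i ^ 2 * zetaReal 3) * hi1
  have q0 : 0 ≤ 2 / ((m : ℝ) + 1) := by positivity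
  -- `h m ≤ m + 1` turns a factor `1 / (m + 1)` into a gain of `h m`
  have q1 : |s| * (2 / ((m : ℝ) + 1)) ≤ 2 * |w| := by
    rw [hs, abs_mul, abs_of_nonneg (h_nonneg m), ← mul_div_assoc, div_le_iff₀ (by positivity)]
    nlinarith [h_le_self m, mul_nonneg (abs_nonneg w) (h_nonneg m), abs_nonneg w]
  have t1 : |s * i * (zetaReal 2 - H2)| ≤ 2 * |w| := by
    rw [abs_mul, abs_mul, abs_of_pos hi0, abs_of_nonneg (by linarith : 0 ≤ zetaReal 2 - H2)]
    calc _ ≤ |s| * 1 * (2 / ((m : ℝ) + 1)) := by gcongr; linarith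
      _ ≤ _ := by linarith
  have t2 : |s ^ 2 * i ^ 2 * (zetaReal 3 * i * (zetaReal 2 - H2) - (zetaReal 3 - H3))| ≤
      2 * |w| := by
    have u1 : |zetaReal 3 * i * (zetaReal 2 - H2) - (zetaReal 3 - H3)| ≤
        2 * (2 / ((m : ℝ) + 1)) := by
      have u2 : zetaReal 3 * i ≤ 2 := by nlinarith
      have u3 : 0 ≤ zetaReal 3 * i := by positivity
      have u4 : zetaReal 3 * i * (zetaReal 2 - H2) ≤ 2 * (2 / ((m : ℝ) + 1)) :=
        mul_le_mul u2 (by linarith) (by linarith) (by norm_num)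
      have u5 : 0 ≤ zetaReal 3 * i * (zetaReal 2 - H2) := mul_nonneg u3 (by linarith)
      rw [abs_le]; constructor <;> linarith
    rw [abs_mul, abs_mul, abs_pow, abs_pow, abs_of_pos hi0]
    have u6 : i ^ 2 ≤ 1 := pow_le_one₀ hi0.le hile
    calc _ ≤ |s| ^ 2 * 1 * (2 * (2 / ((m : ℝ) + 1))) := by gcongr
      _ = 2 * |s| * (|s| * (2 / ((m : ℝ) + 1))) := by ring
      _ ≤ 2 * (1 / 100) * (2 * |w|) := by gcongr; linarith
      _ ≤ _ := by linarith [abs_nonneg w]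
  have t3 : |β * (2 * (s * i) + β) * H3| ≤ 16 * δ ^ 3 + 8 * δ * |η| := by
    have u1 : |β| ≤ 2 * δ ^ 2 + |η| := by
      refine (abs_add_le _ _).trans ?_
      rw [abs_mul, abs_pow, abs_of_nonneg (by positivity : 0 ≤ zetaReal 3 * i ^ 3)]
      have : zetaReal 3 * i ^ 3 ≤ 2 * 1 :=
        mul_le_mul z3' (pow_le_one₀ hi0.le hile) (by positivity) (by norm_num)
      have h2 := mul_le_mul this (pow_le_pow_left₀ (abs_nonneg _) hw 2) (by positivity)
        (by norm_num)
      linarith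
    have u2 : |2 * (s * i) + β| ≤ 4 * δ := by
      refine (abs_add_le _ _).trans ?_
      rw [abs_mul, abs_mul, abs_two, abs_of_pos hi0]
      have h1 : |s| * i ≤ δ * 1 := mul_le_mul hw hile hi0.le hδ0
      have h2 : δ ^ 2 ≤ δ * (1 / 100) := by
        rw [sq]; exact mul_le_mul_of_nonneg_left hδ hδ0
      linarith
    have u3 : |H3| ≤ 2 := by
      rw [abs_of_nonneg]
      · exact harmPow_le_two (by norm_num) m
      · exact Finset.sum_nonneg fun k _ => by positivity
    rw [abs_mul, abs_mul]
    calc _ ≤ (2 * δ ^ 2 + |η|) * (4 * δ) * 2 := by gcongr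
      _ = _ := by ring
  have e' : s - eigen x m + η * H2 =
      (s - (x * H2 - x ^ 2 * H3) + η * H2) - (eigen x m - (x * H2 - x ^ 2 * H3)) := by ring
  rw [e', e]
  rw [abs_le] at b1 t1 t2 t3 ⊢
  have := abs_nonneg w
  constructor <;> linarith

/-- The exponent of the product `riseProd` with local exponents `edgeExponent`. -/
noncomputable def edgeSum (w η : ℝ) (m : ℕ) : ℝ :=
  ∑ k ∈ Finset.range m, edgeExponent w η (h (k + 1)) / ((k : ℝ) + 1)

/-- Sharp two-sided bounds for the exponential moments of the edge-height. The shift `η` is chosen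
to dominate the error terms of `abs_edge_residual_le` and
`abs_sum_riseProd_ratio_add_eigen_le`. -/
theorem exp_edge_bounds {w δ η : ℝ} {m : ℕ} (hw1 : w < 1) (hδ : δ ≤ 1 / 100) (hw : |w| * h m ≤ δ)
    (hη : η = 300 * (|w| + δ ^ 3)) (hηδ : η ≤ δ) :
    expMoment 0 (-Real.log (1 - w)) m ≤ Real.exp (edgeSum w η m) ∧
      Real.exp (edgeSum w (-η) m - 36 * δ ^ 2) ≤ expMoment 0 (-Real.log (1 - w)) m := by
  have hδ0 : 0 ≤ δ := (mul_nonneg (abs_nonneg w) (h_nonneg m)).trans hw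
  have hη0 : 0 ≤ η := by rw [hη]; positivity
  have hexp : Real.exp (-(-Real.log (1 - w))) = 1 - w := by
    rw [neg_neg, Real.exp_log (by linarith)]
  have hc : ∀ k, 0 < k → k ≤ m → 0 < h k - w * h k := fun k hk _ => by
    have := h_pos hk
    nlinarith
  have hφ : ∀ k, 0 < k → k ≤ m →
      ∑ j ∈ Finset.range k, expMoment 0 (-Real.log (1 - w)) j / ((k : ℝ) - j) =
      expMoment 0 (-Real.log (1 - w)) k * (h k - w * h k) := fun k hk _ => by
    rw [expMoment_recursion (by norm_num) _ hk, hexp]; ring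
  have hwk : ∀ k ≤ m, |w * h k| ≤ δ := fun k hk => by
    rw [abs_mul, abs_of_nonneg (h_nonneg k)]
    exact (mul_le_mul_of_nonneg_left (h_mono hk) (abs_nonneg w)).trans hw
  have main : ∀ θ : ℝ, |θ| = η → (∀ k < m, |edgeExponent w θ (h (k + 1))| ≤ 3 * δ) ∧
      ∀ k, 0 < k → k ≤ m →
      0 < riseProd (fun k => edgeExponent w θ (h (k + 1))) k ∧
      |(∑ j ∈ Finset.range k, riseProd (fun k => edgeExponent w θ (h (k + 1))) j / ((k : ℝ) - j)) /
          riseProd (fun k => edgeExponent w θ (h (k + 1))) k - (h k - w * h k) +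
        θ * harmPow 2 k| ≤ η := by
    intro θ hθ
    have hbd : ∀ k < m, |edgeExponent w θ (h (k + 1))| ≤ 3 * δ := fun k hk =>
      abs_edgeExponent_le hδ (hwk (k + 1) hk) (by linarith)
    refine ⟨hbd, fun k hk hkm => ⟨riseProd_pos fun i hi => ?_, ?_⟩⟩
    · linarith [hbd i (by omega)]
    set g := riseProd (fun k => edgeExponent w θ (h (k + 1))) with hg
    have b1 := abs_sum_riseProd_ratio_add_eigen_le (m := k) (δ := 3 * δ) (B := 2 * |w|)
      (y := fun k => edgeExponent w θ (h (k + 1))) (x := edgeExponent w θ (h k)) (by linarith)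
      (abs_edgeExponent_le hδ (hwk k hkm) (by linarith)) (fun i hi => hbd i (by omega))
      (by positivity)
      (by
        have := hwk k hkm
        rw [abs_mul, abs_of_nonneg (h_nonneg k)] at this
        linarith)
      (fun i hi => by
        refine (abs_edgeExponent_sub_le ((hwk k hkm).trans hδ)
          ((hwk (i + 1) (by omega)).trans hδ)).trans ?_
        refine mul_le_mul_of_nonneg_left ?_ (by positivity)
        rw [abs_of_nonneg (sub_nonneg.mpr (h_mono hi))]
        linarith [h_mono (Nat.le_succ i)])
    rw [sum_ratio_sub_one, ← hg] at b1
    have b2 := abs_edge_residual_le (η := θ) hδ (hwk k hkm) (by linarith)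
    rw [hθ] at b2
    have b3 : 8 * |w| + 124 * δ ^ 3 + 8 * δ * η + 128 * (2 * |w|) ≤ η := by
      have : 8 * δ * η ≤ 8 / 100 * η := by nlinarith
      have : 0 ≤ δ ^ 3 := by positivity
      have := abs_nonneg w
      nlinarith
    have e : (∑ j ∈ Finset.range k, g j / ((k : ℝ) - j)) / g k - (h k - w * h k) +
        θ * harmPow 2 k = ((∑ j ∈ Finset.range k, g j / ((k : ℝ) - j)) / g k - h k +
          eigen (edgeExponent w θ (h k)) k) +
        (w * h k - eigen (edgeExponent w θ (h k)) k + θ * harmPow 2 k) := by ring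
    rw [e]
    exact (abs_add_le _ _).trans (by linarith)
  constructor
  · obtain ⟨hbd, h3⟩ := main η (abs_of_nonneg hη0)
    refine (le_of_supersolution (N := m) (expMoment_zero _ _)
      (by rw [riseProd_zero]) hc hφ (fun k hk hkm => ?_) m le_rfl).trans
      (riseProd_le_exp (y := fun k => edgeExponent w η (h (k + 1))) fun k hk => by
        linarith [hbd k hk])
    obtain ⟨p, b⟩ := h3 k hk hkm
    rw [mul_comm, ← div_le_iff₀ p]
    have := (abs_le.mp b).2
    nlinarith [one_le_harmPow 2 hk]
  · obtain ⟨hbd, h3⟩ := main (-η) (by rw [abs_neg, abs_of_nonneg hη0])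
    have hlow := exp_le_riseProd (by linarith) hbd
    rw [← edgeSum, show 4 * (3 * δ) ^ 2 = 36 * δ ^ 2 by ring] at hlow
    refine hlow.trans (le_of_subsolution (N := m) (expMoment_zero _ _)
      (by rw [riseProd_zero]) hc hφ (fun k hk hkm => ?_) m le_rfl)
    obtain ⟨p, b⟩ := h3 k hk hkm
    rw [mul_comm, ← le_div_iff₀ p]
    have := (abs_le.mp b).1
    nlinarith [one_le_harmPow 2 hk]

theorem sum_h_succ_div (m : ℕ) :
    ∑ k ∈ Finset.range m, h (k + 1) / ((k : ℝ) + 1) = (h m ^ 2 + harmPow 2 m) / 2 := by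
  induction m with
  | zero => simp [h_zero, harmPow]
  | succ m ih =>
    rw [Finset.sum_range_succ, ih, harmPow_succ, h_succ]
    have : (m : ℝ) + 1 ≠ 0 := by positivity
    field_simp
    ring

theorem sum_h_succ_sq_div (m : ℕ) :
    h m ^ 3 / 3 ≤ ∑ k ∈ Finset.range m, h (k + 1) ^ 2 / ((k : ℝ) + 1) ∧
    ∑ k ∈ Finset.range m, h (k + 1) ^ 2 / ((k : ℝ) + 1) ≤ h m ^ 3 / 3 + h m * harmPow 2 m := by
  induction m with
  | zero => simp [h_zero, harmPow]
  | succ m ih =>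
    rw [Finset.sum_range_succ, harmPow_succ]
    have hm1 : h (m + 1) = h m + 1 / ((m : ℝ) + 1) := h_succ m
    set t := 1 / ((m : ℝ) + 1) with ht
    have ht0 : 0 < t := by positivity
    have e1 : h (m + 1) ^ 2 / ((m : ℝ) + 1) = h (m + 1) ^ 2 * t := by rw [ht]; ring
    have e2 : 1 / ((m : ℝ) + 1) ^ 2 = t ^ 2 := by rw [ht, one_div_pow]
    have hh := h_nonneg m
    have hH : 0 ≤ harmPow 2 m := Finset.sum_nonneg fun k _ => by positivity
    rw [e1, e2, hm1]
    have p1 : 0 ≤ h m * t ^ 2 := by positivity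
    have p2 : 0 ≤ t ^ 3 := by positivity
    have p3 : 0 ≤ t * harmPow 2 m := by positivity
    constructor <;> nlinarith [ih.1, ih.2]

theorem abs_edgeSum_sub_le {w η : ℝ} {m : ℕ} (hw : |w| * h m ≤ 1 / 100) :
    |edgeSum w η m - (w * h m ^ 2 / (2 * zetaReal 2) +
      zetaReal 3 / (3 * zetaReal 2 ^ 3) * (w ^ 2 * h m ^ 3) + η * h m)| ≤ 2 * |w| := by
  obtain ⟨c0, c2⟩ := zeta_ratio_mem
  have z2 := one_le_zetaReal (le_refl 2)
  set c := zetaReal 3 / zetaReal 2 ^ 3 with hc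
  set S := ∑ k ∈ Finset.range m, h (k + 1) ^ 2 / ((k : ℝ) + 1) with hS
  have e : edgeSum w η m = w / zetaReal 2 * ((h m ^ 2 + harmPow 2 m) / 2) + c * w ^ 2 * S +
      η * h m := by
    rw [← sum_h_succ_div, ← sum_const_div, hS, Finset.mul_sum, Finset.mul_sum,
      ← Finset.sum_add_distrib, ← Finset.sum_add_distrib, edgeSum]
    refine Finset.sum_congr rfl fun k _ => ?_
    rw [edgeExponent]
    ring
  have e2 : edgeSum w η m - (w * h m ^ 2 / (2 * zetaReal 2) +
      zetaReal 3 / (3 * zetaReal 2 ^ 3) * (w ^ 2 * h m ^ 3) + η * h m) =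
      w * (harmPow 2 m / 2) / zetaReal 2 + c * w ^ 2 * (S - h m ^ 3 / 3) := by
    rw [e, hc]; field_simp; ring
  have hH := harmPow_le_two (le_refl 2) m
  have hH0 : 0 ≤ harmPow 2 m := Finset.sum_nonneg fun k _ => by positivity
  have t1 : |w * (harmPow 2 m / 2) / zetaReal 2| ≤ |w| := by
    refine (abs_div_zeta_le _).trans ?_
    rw [abs_mul, abs_of_nonneg (by positivity : 0 ≤ harmPow 2 m / 2)]
    exact mul_le_of_le_one_right (abs_nonneg w) (by linarith)
  have t2 : |c * w ^ 2 * (S - h m ^ 3 / 3)| ≤ |w| := by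
    obtain ⟨s1, s2⟩ := sum_h_succ_sq_div m
    rw [abs_mul, abs_of_nonneg (by positivity : 0 ≤ c * w ^ 2),
      abs_of_nonneg (by linarith : 0 ≤ S - h m ^ 3 / 3), ← sq_abs w]
    have hh := h_nonneg m
    calc c * |w| ^ 2 * (S - h m ^ 3 / 3) ≤ 2 * |w| ^ 2 * (h m * 2) := by
          gcongr
          nlinarith
      _ = 4 * |w| * (|w| * h m) := by ring
      _ ≤ 4 * |w| * (1 / 100) := by gcongr
      _ ≤ |w| := by linarith [abs_nonneg w]
  rw [e2]
  exact (abs_add_le _ _).trans (by linarith)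

/-! ### The limits of the Laplace transforms -/

theorem tendsto_log_succ : Tendsto (fun m : ℕ => Real.log ((m : ℝ) + 1)) atTop atTop :=
  Real.tendsto_log_atTop.comp (tendsto_atTop_add_const_right _ _ tendsto_natCast_atTop_atTop)

theorem tendsto_div_sqrt_log (a : ℝ) :
    Tendsto (fun m : ℕ => a / √(Real.log ((m : ℝ) + 1))) atTop (𝓝 0) :=
  tendsto_const_nhds.div_atTop (Real.tendsto_sqrt_atTop.comp tendsto_log_succ)

theorem tendsto_of_abs_sub_le {f b : ℕ → ℝ} {a : ℝ} (hb : Tendsto b atTop (𝓝 0))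
    (hf : ∀ᶠ m in atTop, |f m - a| ≤ b m) : Tendsto f atTop (𝓝 a) := by
  rw [tendsto_iff_norm_sub_tendsto_zero]
  exact squeeze_zero' (Eventually.of_forall fun _ => norm_nonneg _) hf hb

theorem tendsto_of_mul_exp_bounds {f e₁ e₂ : ℕ → ℝ} {b : ℕ → ℝ} {a : ℝ}
    (hb : Tendsto b atTop (𝓝 0)) (h₁ : Tendsto e₁ atTop (𝓝 a)) (h₂ : Tendsto e₂ atTop (𝓝 a))
    (hlo : ∀ᶠ m in atTop, (1 - b m) * Real.exp (e₁ m) ≤ f m)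
    (hup : ∀ᶠ m in atTop, f m ≤ (1 + b m) * Real.exp (e₂ m)) :
    Tendsto f atTop (𝓝 (Real.exp a)) := by
  have t1 : Tendsto (fun m => (1 - b m) * Real.exp (e₁ m)) atTop (𝓝 ((1 - 0) * Real.exp a)) :=
    (tendsto_const_nhds.sub hb).mul ((Real.continuous_exp.tendsto a).comp h₁)
  have t2 : Tendsto (fun m => (1 + b m) * Real.exp (e₂ m)) atTop (𝓝 ((1 + 0) * Real.exp a)) :=
    (tendsto_const_nhds.add hb).mul ((Real.continuous_exp.tendsto a).comp h₂)
  rw [sub_zero, one_mul] at t1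
  rw [add_zero, one_mul] at t2
  exact tendsto_of_tendsto_of_tendsto_of_le_of_le' t1 t2 hlo hup

/-- The Laplace transform of the centred time-height at a parameter of order `(log n) ^ (-1/2)`,
written as `ζ(2) x - ζ(3) x²` with `x = v / √(log n)`. -/
theorem tendsto_exp_mul_expMoment_time {v : ℝ} (hv : v ≠ 0) :
    Tendsto (fun m : ℕ =>
      Real.exp (-((zetaReal 2 * (v / √(Real.log ((m : ℝ) + 1))) -
        zetaReal 3 * (v / √(Real.log ((m : ℝ) + 1))) ^ 2) * (Real.log ((m : ℝ) + 1) / zetaReal 2))) *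
      expMoment (zetaReal 2 * (v / √(Real.log ((m : ℝ) + 1))) -
        zetaReal 3 * (v / √(Real.log ((m : ℝ) + 1))) ^ 2) 0 m) atTop
      (𝓝 (Real.exp (zetaReal 3 / zetaReal 2 * v ^ 2))) := by
  set x : ℕ → ℝ := fun m => v / √(Real.log ((m : ℝ) + 1)) with hx
  have z2 := one_le_zetaReal (le_refl 2)
  have hx0 : Tendsto x atTop (𝓝 0) := tendsto_div_sqrt_log v
  have hxabs : Tendsto (fun m => |x m|) atTop (𝓝 0) := by simpa using hx0.abs
  set p : ℕ → ℝ := fun m =>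
    -((zetaReal 2 * x m - zetaReal 3 * x m ^ 2) * (Real.log ((m : ℝ) + 1) / zetaReal 2)) with hp
  have hev : ∀ᶠ m : ℕ in atTop, x m ≠ 0 ∧ |x m| ≤ 1 / 100 ∧
      |p m + x m * h m - zetaReal 3 / zetaReal 2 * v ^ 2| ≤ |x m| ∧
      10 * |x m| ^ 3 * h m ≤ 20 * v ^ 2 * |x m| := by
    filter_upwards [tendsto_log_succ.eventually_ge_atTop 1,
      hxabs.eventually (ge_mem_nhds (show (0 : ℝ) < 1 / 100 by norm_num))] with m h1 h2
    set l := Real.log ((m : ℝ) + 1) with hl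
    have hs : 0 < √l := Real.sqrt_pos.mpr (by linarith)
    have hsq : x m ^ 2 * l = v ^ 2 := by
      have e : x m = v / √l := rfl
      rw [e, div_pow, Real.sq_sqrt (by linarith)]
      field_simp
    have hl1 := log_le_h m
    have hl2 := h_le_one_add_log m
    refine ⟨div_ne_zero hv hs.ne', h2, ?_, ?_⟩
    · have e : p m + x m * h m - zetaReal 3 / zetaReal 2 * v ^ 2 = x m * (h m - l) := by
        rw [← hsq]
        simp only [hp]
        field_simp
        ring
      rw [e, abs_mul, abs_of_nonneg (by linarith : 0 ≤ h m - l)]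
      exact mul_le_of_le_one_right (abs_nonneg _) (by linarith)
    · have h3 : h m ≤ 2 * l := by linarith
      calc 10 * |x m| ^ 3 * h m ≤ 10 * |x m| ^ 3 * (2 * l) := by gcongr
        _ = 20 * (|x m| ^ 2 * l) * |x m| := by ring
        _ = _ := by rw [sq_abs, hsq]
  refine tendsto_of_mul_exp_bounds (b := fun m => 24 * |x m|)
    (e₁ := fun m => p m + ((x m - 10 * |x m| ^ 3) * h m - 16 * |x m| ^ 2))
    (e₂ := fun m => p m + (x m + 10 * |x m| ^ 3) * h m) (by simpa using hxabs.const_mul 24)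
    (tendsto_of_abs_sub_le (b := fun m => |x m| + 20 * v ^ 2 * |x m| + 16 * |x m| ^ 2) ?_ ?_)
    (tendsto_of_abs_sub_le (b := fun m => |x m| + 20 * v ^ 2 * |x m|) ?_ ?_) ?_ ?_
  · simpa using (hxabs.add (hxabs.const_mul (20 * v ^ 2))).add ((hxabs.pow 2).const_mul 16)
  · filter_upwards [hev] with m ⟨_, _, a1, a2⟩
    have a3 : 0 ≤ 10 * |x m| ^ 3 * h m := by have := h_nonneg m; positivity
    have a4 := sq_nonneg |x m|
    rw [abs_le] at a1 ⊢
    constructor <;> linarith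
  · simpa using hxabs.add (hxabs.const_mul (20 * v ^ 2))
  · filter_upwards [hev] with m ⟨_, _, a1, a2⟩
    have a3 : 0 ≤ 10 * |x m| ^ 3 * h m := by have := h_nonneg m; positivity
    rw [abs_le] at a1 ⊢
    constructor <;> linarith
  · filter_upwards [hev] with m ⟨b1, b2, _, _⟩
    rw [Real.exp_add, mul_left_comm]
    exact mul_le_mul_of_nonneg_left (exp_time_bounds b1 b2 m).2 (Real.exp_nonneg _)
  · filter_upwards [hev] with m ⟨b1, b2, _, _⟩
    rw [Real.exp_add, mul_left_comm]
    exact mul_le_mul_of_nonneg_left (exp_time_bounds b1 b2 m).1 (Real.exp_nonneg _)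

theorem abs_neg_log_one_sub_sub_le {w : ℝ} (hw : |w| ≤ 1 / 2) :
    |-Real.log (1 - w) - w| ≤ 2 * w ^ 2 := by
  obtain ⟨h1, h2⟩ := abs_le.mp hw
  have hp : 0 < 1 - w := by linarith
  have u1 := Real.log_le_sub_one_of_pos hp
  have u2 := Real.one_sub_inv_le_log_of_pos hp
  have u3 : (1 - w)⁻¹ ≤ 1 + w + 2 * w ^ 2 := by
    rw [inv_le_iff_one_le_mul₀ hp]
    nlinarith [sq_nonneg w, mul_nonneg (sq_nonneg w) (by linarith : 0 ≤ 1 - 2 * w)]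
  rw [abs_le]
  constructor <;> nlinarith [sq_nonneg w]

/-- Homogeneity in `l` of `w = v / l ^ (3/2)`. -/
theorem edge_scale {v l : ℝ} (hl : 1 ≤ l) :
    |v / (l * √l)| * l = |v| / √l ∧ |v / (l * √l)| ≤ |v| / √l ∧
      (v / (l * √l)) ^ 2 * l ^ 3 = v ^ 2 ∧ (|v| / √l) ^ 2 * l = v ^ 2 := by
  have hl0 : 0 < l := by linarith
  have hs : 0 < √l := Real.sqrt_pos.mpr hl0
  have e1 : |v / (l * √l)| * l = |v| / √l := by
    rw [abs_div, abs_of_pos (by positivity : 0 < l * √l)]; field_simp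
  refine ⟨e1, ?_, ?_, ?_⟩
  · rw [← e1]; exact le_mul_of_one_le_right (abs_nonneg _) hl
  · rw [div_pow, mul_pow, Real.sq_sqrt hl0.le]; field_simp
  · rw [div_pow, Real.sq_sqrt hl0.le, sq_abs]; field_simp

/-- The exponent of the edge-height estimate, centred by its main term. -/
theorem abs_edge_exponent_sub_le {v l H w δ : ℝ} (hl : 600 ≤ l) (hH1 : l ≤ H) (hH2 : H ≤ 1 + l)
    (hw : |w| * l = δ / 2) (hwv : w ^ 2 * l ^ 3 = v ^ 2) (hδ0 : 0 ≤ δ) (hδ : δ ≤ 1 / 100)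
    (hw2 : |w| ≤ 1 / 2) :
    |-(-Real.log (1 - w) * (l ^ 2 / (2 * zetaReal 2))) + (w * H ^ 2 / (2 * zetaReal 2) +
      zetaReal 3 / (3 * zetaReal 2 ^ 3) * (w ^ 2 * H ^ 3)) -
        zetaReal 3 / (3 * zetaReal 2 ^ 3) * v ^ 2| ≤ 4 * δ := by
  set c := zetaReal 3 / (3 * zetaReal 2 ^ 3) with hc
  have z2 := one_le_zetaReal (le_refl 2)
  have hc0 : 0 < c ∧ c ≤ 1 := by
    obtain ⟨a, b⟩ := zeta_ratio_mem
    have e : c = zetaReal 3 / zetaReal 2 ^ 3 / 3 := by rw [hc]; field_simp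
    constructor <;> rw [e] <;> linarith
  have lg := abs_neg_log_one_sub_sub_le hw2
  set w' := -Real.log (1 - w) with hw'
  have e : -(w' * (l ^ 2 / (2 * zetaReal 2))) + (w * H ^ 2 / (2 * zetaReal 2) +
      c * (w ^ 2 * H ^ 3)) - c * v ^ 2 =
      (w * (H ^ 2 - l ^ 2) / 2 - (w' - w) * l ^ 2 / 2) / zetaReal 2 +
        c * (w ^ 2 * (H ^ 3 - l ^ 3)) := by
    rw [← hwv]
    field_simp
    ring
  have wl2 : w ^ 2 * l ^ 2 ≤ δ / 400 := by
    have : w ^ 2 * l ^ 2 = (|w| * l) ^ 2 := by rw [mul_pow, sq_abs]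
    rw [this, hw]
    nlinarith
  have sq1 : l ^ 2 ≤ H ^ 2 := pow_le_pow_left₀ (by linarith) hH1 2
  have sq2 : H ^ 2 ≤ (1 + l) ^ 2 := pow_le_pow_left₀ (by linarith) hH2 2
  have t1 : |w * (H ^ 2 - l ^ 2) / 2| ≤ δ := by
    rw [abs_div, abs_mul, abs_two, abs_of_nonneg (by linarith : 0 ≤ H ^ 2 - l ^ 2)]
    have h1 : H ^ 2 - l ^ 2 ≤ 3 * l := by linarith
    have := mul_le_mul_of_nonneg_left h1 (abs_nonneg w)
    linarith
  have t2 : |(w' - w) * l ^ 2 / 2| ≤ δ := by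
    rw [abs_div, abs_mul, abs_two, abs_of_nonneg (sq_nonneg l)]
    have := mul_le_mul_of_nonneg_right lg (sq_nonneg l)
    linarith
  have t3 : |c * (w ^ 2 * (H ^ 3 - l ^ 3))| ≤ δ := by
    have u1 : 0 ≤ H ^ 3 - l ^ 3 := sub_nonneg.mpr (pow_le_pow_left₀ (by linarith) hH1 3)
    have u2 : H ^ 3 - l ^ 3 ≤ 7 * l ^ 2 := by
      have v1 : H ^ 3 ≤ (1 + l) ^ 3 := pow_le_pow_left₀ (by linarith) hH2 3
      have v2 : 600 * l ≤ l ^ 2 := by rw [sq]; exact mul_le_mul_of_nonneg_right hl (by linarith)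
      linarith
    have u3 := mul_le_mul_of_nonneg_left u2 (sq_nonneg w)
    have u4 : 0 ≤ w ^ 2 * (H ^ 3 - l ^ 3) := mul_nonneg (sq_nonneg _) u1
    rw [abs_of_nonneg (mul_nonneg hc0.1.le u4)]
    have u5 := mul_le_of_le_one_left u4 hc0.2
    linarith
  rw [e]
  refine (abs_add_le _ _).trans ?_
  have := (abs_div_zeta_le (w * (H ^ 2 - l ^ 2) / 2 - (w' - w) * l ^ 2 / 2)).trans
    (abs_sub _ _)
  linarith

/-- The size conditions needed for `exp_edge_bounds`; `l ≥ 600` ensures `300 * |w| ≤ δ / 4`, hence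
`η ≤ δ`. -/
theorem edge_scale_bounds {v l H w δ η : ℝ} (hl : 600 ≤ l) (hH1 : l ≤ H) (hH2 : H ≤ 1 + l)
    (hw : w = v / (l * √l)) (hδ : δ = 2 * (|v| / √l)) (hη : η = 300 * (|w| + δ ^ 3))
    (hδ1 : δ ≤ 1 / 100) :
    |w| * H ≤ δ ∧ 0 ≤ η ∧ η ≤ δ ∧ η * H ≤ (300 + 2400 * v ^ 2) * δ ∧ |w| ≤ δ ∧
    |-(-Real.log (1 - w) * (l ^ 2 / (2 * zetaReal 2))) + (w * H ^ 2 / (2 * zetaReal 2) +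
      zetaReal 3 / (3 * zetaReal 2 ^ 3) * (w ^ 2 * H ^ 3)) -
        zetaReal 3 / (3 * zetaReal 2 ^ 3) * v ^ 2| ≤ 4 * δ := by
  obtain ⟨s1, s2, s3, s4⟩ := edge_scale (v := v) (show 1 ≤ l by linarith)
  have s1' : |w| * l = δ / 2 := by rw [hδ, hw, s1]; ring
  have s3' : w ^ 2 * l ^ 3 = v ^ 2 := by rw [hw]; exact s3
  have s4' : δ ^ 2 * l = 4 * v ^ 2 := by rw [hδ, mul_pow, mul_assoc, s4]; ring
  have w0 := abs_nonneg w
  have s2' : |w| ≤ δ / 1200 := by nlinarith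
  have d0 : 0 ≤ δ := by linarith
  have hh : H ≤ 2 * l := by linarith
  have b1 : |w| * H ≤ δ := by nlinarith
  have b2 : 0 ≤ η := by rw [hη]; positivity
  have d3 : δ ^ 3 ≤ δ / 10000 := by
    have : δ ^ 2 ≤ (1 / 100) ^ 2 := pow_le_pow_left₀ d0 hδ1 2
    nlinarith
  have b3 : η ≤ δ := by rw [hη]; linarith
  have b5 : η * H ≤ (300 + 2400 * v ^ 2) * δ := by
    calc η * H ≤ η * (2 * l) := mul_le_mul_of_nonneg_left hh b2
      _ = 600 * (|w| * l) + 600 * (δ ^ 2 * l) * δ := by rw [hη]; ring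
      _ = _ := by rw [s1', s4']; ring
  exact ⟨b1, b2, b3, b5, by linarith,
    abs_edge_exponent_sub_le hl hH1 hH2 s1' s3' d0 hδ1 (by linarith)⟩

/-- The Laplace transform of the centred edge-height at a parameter `w'` of order
`(log n) ^ (-3/2)`, given by `1 - e^(-w') = v / (log n) ^ (3/2)`. -/
theorem tendsto_exp_mul_expMoment_edge (v : ℝ) :
    Tendsto (fun m : ℕ =>
      Real.exp (-(-Real.log (1 - v / (Real.log ((m : ℝ) + 1) * √(Real.log ((m : ℝ) + 1)))) *
        (Real.log ((m : ℝ) + 1) ^ 2 / (2 * zetaReal 2)))) *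
      expMoment 0 (-Real.log (1 - v / (Real.log ((m : ℝ) + 1) * √(Real.log ((m : ℝ) + 1))))) m) atTop
      (𝓝 (Real.exp (zetaReal 3 / (3 * zetaReal 2 ^ 3) * v ^ 2))) := by
  set l : ℕ → ℝ := fun m => Real.log ((m : ℝ) + 1) with hl
  set w : ℕ → ℝ := fun m => v / (l m * √(l m)) with hw
  set δ : ℕ → ℝ := fun m => 2 * (|v| / √(l m)) with hδ
  set η : ℕ → ℝ := fun m => 300 * (|w m| + δ m ^ 3) with hη
  set p : ℕ → ℝ := fun m => -(-Real.log (1 - w m) * (l m ^ 2 / (2 * zetaReal 2))) with hp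
  set c := zetaReal 3 / (3 * zetaReal 2 ^ 3) with hc
  have z2 := one_le_zetaReal (le_refl 2)
  have hδ0 : Tendsto δ atTop (𝓝 0) := by
    simpa using (tendsto_div_sqrt_log |v|).const_mul 2
  have hev : ∀ᶠ m : ℕ in atTop, |w m| * h m ≤ δ m ∧ δ m ≤ 1 / 100 ∧ w m < 1 ∧ 0 ≤ η m ∧ η m ≤ δ m ∧
      |p m + (w m * h m ^ 2 / (2 * zetaReal 2) + c * (w m ^ 2 * h m ^ 3)) - c * v ^ 2| ≤ 4 * δ m ∧
      η m * h m ≤ (300 + 2400 * v ^ 2) * δ m ∧ |w m| ≤ δ m := by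
    filter_upwards [tendsto_log_succ.eventually_ge_atTop 600,
      hδ0.eventually (ge_mem_nhds (show (0 : ℝ) < 1 / 100 by norm_num))] with m h1 h2
    have hl1 : l m ≤ h m := log_le_h m
    have hl2 : h m ≤ 1 + l m := h_le_one_add_log m
    obtain ⟨b1, b2, b3, b4, b5, b6⟩ := edge_scale_bounds (v := v) h1 hl1 hl2 (w := w m) (δ := δ m)
      rfl rfl (η := η m) rfl h2
    exact ⟨b1, h2, by linarith [le_abs_self (w m)], b2, b3, b6, b4, b5⟩
  refine tendsto_of_mul_exp_bounds (b := fun _ => 0)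
    (e₁ := fun m => p m + (edgeSum (w m) (-η m) m - 36 * δ m ^ 2))
    (e₂ := fun m => p m + edgeSum (w m) (η m) m) tendsto_const_nhds
    (tendsto_of_abs_sub_le (b := fun m => (310 + 2400 * v ^ 2) * δ m + 36 * δ m ^ 2) ?_ ?_)
    (tendsto_of_abs_sub_le (b := fun m => (310 + 2400 * v ^ 2) * δ m) ?_ ?_) ?_ ?_
  · simpa using (hδ0.const_mul (310 + 2400 * v ^ 2)).add ((hδ0.pow 2).const_mul 36)
  · filter_upwards [hev] with m ⟨a1, a2, a3, a4, a5, a6, a7, a8⟩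
    have a9 := abs_edgeSum_sub_le (η := -η m) (a1.trans a2)
    rw [← hc] at a9
    have a10 : 0 ≤ η m * h m := mul_nonneg a4 (h_nonneg m)
    have a11 := sq_nonneg (δ m)
    rw [abs_le] at a6 a9 ⊢
    constructor <;> linarith [a9.1, a9.2, a6.1, a6.2]
  · simpa using hδ0.const_mul (310 + 2400 * v ^ 2)
  · filter_upwards [hev] with m ⟨a1, a2, a3, a4, a5, a6, a7, a8⟩
    have a9 := abs_edgeSum_sub_le (η := η m) (a1.trans a2)
    rw [← hc] at a9
    have a10 : 0 ≤ η m * h m := mul_nonneg a4 (h_nonneg m)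
    rw [abs_le] at a6 a9 ⊢
    constructor <;> linarith [a9.1, a9.2, a6.1, a6.2]
  · filter_upwards [hev] with m ⟨a1, a2, a3, a4, a5, _⟩
    rw [Real.exp_add, sub_zero, one_mul]
    exact mul_le_mul_of_nonneg_left (exp_edge_bounds a3 a2 a1 rfl a5).2 (Real.exp_nonneg _)
  · filter_upwards [hev] with m ⟨a1, a2, a3, a4, a5, _⟩
    rw [Real.exp_add, add_zero, one_mul]
    exact mul_le_mul_of_nonneg_left (exp_edge_bounds a3 a2 a1 rfl a5).1 (Real.exp_nonneg _)

/-! ### The normal limit -/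

theorem integral_exp_mul_gaussianReal (u : ℝ) :
    ∫ x, Real.exp (u * x) ∂(gaussianReal 0 1) = Real.exp (u ^ 2 / 2) := by
  have := congrFun (mgf_fun_id_gaussianReal (μ := 0) (v := 1)) u
  simpa [mgf] using this

theorem integrable_exp_mul_abs_gaussianReal (r : ℝ) :
    Integrable (fun x => Real.exp (r * |x|)) (gaussianReal 0 1) :=
  integrable_exp_mul_abs (integrable_exp_mul_gaussianReal r) (integrable_exp_mul_gaussianReal (-r))

theorem tendsto_natPred_atTop : Tendsto PNat.natPred atTop atTop :=
  OrderIso.pnatIsoNat.tendsto_atTop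

/-- Convergence of Laplace transforms to that of the standard normal law yields convergence in
distribution and of all moments, for random variables on a sequence of probability spaces. -/
theorem normal_limit_of_tendstoLaplace (X : (n : ℕ+) → Sample n → ℝ)
    (hX : ∀ n, Measurable (X n))
    (H : TendstoLaplace (fun m => (sampleMeasure m.succPNat).map (X m.succPNat))
      (gaussianReal 0 1)) :
    TendstoInDistribution X atTop (id : ℝ → ℝ) (fun n : ℕ+ => sampleMeasure n)
        (gaussianReal 0 1) ∧
      ∀ k : ℕ, Tendsto (fun n : ℕ+ => ∫ s, X n s ^ k ∂(sampleMeasure n)) atTop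
        (𝓝 (∫ x, x ^ k ∂(gaussianReal 0 1))) := by
  have hp : ∀ n : ℕ+, IsProbabilityMeasure ((sampleMeasure n).map (X n)) := fun n =>
    Measure.isProbabilityMeasure_map (hX n).aemeasurable
  constructor
  · refine ⟨fun n => (hX n).aemeasurable, aemeasurable_id, ?_⟩
    have key : Tendsto (β := ProbabilityMeasure ℝ)
        (fun m : ℕ => ⟨(sampleMeasure m.succPNat).map (X m.succPNat), hp m.succPNat⟩) atTop
        (𝓝 ⟨(gaussianReal 0 1).map id, Measure.isProbabilityMeasure_map aemeasurable_id⟩) := by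
      refine ProbabilityMeasure.tendsto_of_tendsto_charFun fun t => ?_
      simpa only [ProbabilityMeasure.coe_mk, Measure.map_id] using
        H.tendsto_charFun integrable_exp_mul_abs_gaussianReal t
    exact (key.comp tendsto_natPred_atTop).congr fun n =>
      congrArg (fun n : ℕ+ => (⟨(sampleMeasure n).map (X n), hp n⟩ : ProbabilityMeasure ℝ))
        n.succPNat_natPred
  · intro k
    have key := (H.tendsto_moment integrable_exp_mul_abs_gaussianReal k).comp tendsto_natPred_atTop
    refine key.congr fun n => ?_
    rw [← integral_map (hX n).aemeasurable (f := fun x : ℝ => x ^ k) (by fun_prop)]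
    exact congrArg (fun n : ℕ+ => ∫ x, x ^ k ∂((sampleMeasure n).map (X n))) n.succPNat_natPred

/-- For `σ = 0` the quotient is the constant `0`; this occurs for trees with one leaf. -/
theorem integrable_affine_pow {Ω : Type*} {mΩ : MeasurableSpace Ω} {P : Measure Ω}
    [IsProbabilityMeasure P] {Y : Ω → ℝ} (hY : ∀ z : ℝ, |z| ≤ 1 / 2 →
      Integrable (fun s => Real.exp (z * Y s)) P) (b σ : ℝ) (k : ℕ) :
    Integrable (fun s => ((Y s - b) / σ) ^ k) P := by
  rcases eq_or_ne σ 0 with rfl | hσ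
  · simp
  · have key : ∀ z : ℝ, |z| ≤ 1 / 2 →
        Integrable (fun s => Real.exp (z * σ * ((Y s - b) / σ))) P := by
      intro z hz
      have e : (fun s => Real.exp (z * σ * ((Y s - b) / σ))) =
          fun s => Real.exp (-(z * b)) * Real.exp (z * Y s) := by
        funext s
        rw [← Real.exp_add]
        congr 1
        field_simp
        ring
      rw [e]
      exact (hY z hz).const_mul _
    have h1 := key (1 / 2) (by rw [abs_of_pos (by norm_num)])
    have h2 := key (-(1 / 2)) (by rw [abs_neg, abs_of_pos (by norm_num)])
    rw [neg_mul] at h2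
    exact integrable_pow_of_integrable_exp_mul (t := 1 / 2 * σ) (by simpa using hσ) h1 h2 k

theorem integrable_exp_D {z : ℝ} (hz : z < 1) (n : ℕ) [NeZero n] :
    Integrable (fun s => Real.exp (z * D n s)) (sampleMeasure n) := by
  obtain ⟨m, rfl⟩ := Nat.exists_eq_succ_of_ne_zero (NeZero.ne n)
  simpa using (integrable_exp_D_L hz 0 m).1

theorem integrable_exp_L (w : ℝ) (n : ℕ) [NeZero n] :
    Integrable (fun s => Real.exp (w * L n s)) (sampleMeasure n) := by
  obtain ⟨m, rfl⟩ := Nat.exists_eq_succ_of_ne_zero (NeZero.ne n)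
  simpa using (integrable_exp_D_L zero_lt_one w m).1

theorem measurable_normalizedD (n : ℕ) [NeZero n] : Measurable (normalizedD n) :=
  ((measurable_D n).sub_const _).div_const _

theorem measurable_normalizedL (n : ℕ) [NeZero n] : Measurable (normalizedL n) :=
  ((measurable_L_real n).sub_const _).div_const _

theorem tendstoLaplace_of_forall_ne_zero {μ : ℕ → Measure ℝ} {ν : Measure ℝ}
    [∀ n, IsProbabilityMeasure (μ n)] [IsProbabilityMeasure ν]
    (H : ∀ u : ℝ, u ≠ 0 → ∃ s : ℕ → ℝ, Tendsto s atTop (𝓝 u) ∧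
      (∀ᶠ n in atTop, Integrable (fun x => Real.exp (s n * x)) (μ n)) ∧
      Tendsto (fun n => ∫ x, Real.exp (s n * x) ∂(μ n)) atTop (𝓝 (∫ x, Real.exp (u * x) ∂ν))) :
    TendstoLaplace μ ν := by
  intro u
  rcases eq_or_ne u 0 with rfl | hu
  · exact ⟨fun _ => 0, tendsto_const_nhds, by simp, by simp⟩
  · exact H u hu

theorem tendstoLaplace_normalizedD :
    TendstoLaplace (fun m => (sampleMeasure m.succPNat).map (normalizedD m.succPNat))
      (gaussianReal 0 1) := by
  have hp : ∀ m : ℕ, IsProbabilityMeasure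
      ((sampleMeasure m.succPNat).map (normalizedD m.succPNat)) := fun m =>
    Measure.isProbabilityMeasure_map (measurable_normalizedD _).aemeasurable
  refine tendstoLaplace_of_forall_ne_zero fun u hu => ?_
  have z2 := one_le_zetaReal (le_refl 2)
  have z3 := one_le_zetaReal (show 2 ≤ 3 by norm_num)
  set c := 2 * zetaReal 3 / zetaReal 2 ^ 3 with hc
  have hc0 : 0 < c := by positivity
  have hsc : 0 < √c := Real.sqrt_pos.mpr hc0
  set v := u / (zetaReal 2 * √c) with hv
  have hv0 : v ≠ 0 := div_ne_zero hu (by positivity)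
  set l : ℕ → ℝ := fun m => Real.log ((m : ℝ) + 1) with hl
  set x : ℕ → ℝ := fun m => v / √(l m) with hx
  set z : ℕ → ℝ := fun m => zetaReal 2 * x m - zetaReal 3 * x m ^ 2 with hz
  have hx0 : Tendsto x atTop (𝓝 0) := tendsto_div_sqrt_log v
  have hz0 : Tendsto z atTop (𝓝 0) := by
    simpa using (hx0.const_mul (zetaReal 2)).sub ((hx0.pow 2).const_mul (zetaReal 3))
  have e : ∀ m : ℕ, 0 < l m → ∀ s, Real.exp (z m * √(c * l m) * normalizedD m.succPNat s) =
      Real.exp (-(z m * (l m / zetaReal 2))) *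
        Real.exp (z m * D (m + 1) s + 0 * L (m + 1) s) := by
    intro m hm s
    rw [← Real.exp_add, normalizedD]
    congr 1
    have h1 : √(c * l m) ≠ 0 := (Real.sqrt_pos.mpr (mul_pos hc0 hm)).ne'
    have h2 : ((m.succPNat : ℕ) : ℝ) = (m : ℝ) + 1 := by simp
    rw [h2]
    change z m * √(c * l m) * ((D (m + 1) s - l m / zetaReal 2) / √(c * l m)) = _
    field_simp
    ring
  have hev : ∀ᶠ m : ℕ in atTop, 0 < l m ∧ z m < 1 :=
    (tendsto_log_succ.eventually_gt_atTop 0).and (hz0.eventually (gt_mem_nhds zero_lt_one))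
  refine ⟨fun m => z m * √(c * l m), ?_, ?_, ?_⟩
  · have h1 : Tendsto (fun m => zetaReal 2 * v * √c - zetaReal 3 * v * √c * x m) atTop (𝓝 u) := by
      have h2 : u = zetaReal 2 * v * √c - zetaReal 3 * v * √c * 0 := by rw [hv]; field_simp; ring
      rw [h2]
      exact tendsto_const_nhds.sub (hx0.const_mul _)
    refine h1.congr' ?_
    filter_upwards [hev] with m hm
    have h3 : √(l m) ≠ 0 := (Real.sqrt_pos.mpr hm.1).ne'
    simp only [hz, hx]
    rw [Real.sqrt_mul hc0.le]
    field_simp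
  · filter_upwards [hev] with m hm
    rw [integrable_map_measure (by fun_prop) (measurable_normalizedD _).aemeasurable]
    refine Integrable.congr ?_ (ae_of_all _ fun s => (e m hm.1 s).symm)
    exact (integrable_exp_D_L hm.2 0 m).1.const_mul _
  · have hlim := tendsto_exp_mul_expMoment_time hv0
    have hu2 : zetaReal 3 / zetaReal 2 * v ^ 2 = u ^ 2 / 2 := by
      rw [hv, div_pow, mul_pow, Real.sq_sqrt hc0.le, hc]
      field_simp
    rw [hu2, ← integral_exp_mul_gaussianReal] at hlim
    refine hlim.congr' ?_
    filter_upwards [hev] with m hm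
    rw [integral_map (measurable_normalizedD _).aemeasurable (by fun_prop)]
    rw [integral_congr_ae (ae_of_all _ (e m hm.1)), integral_const_mul]
    congr 1
    exact (integrable_exp_D_L hm.2 0 m).2.symm

theorem tendstoLaplace_normalizedL :
    TendstoLaplace (fun m => (sampleMeasure m.succPNat).map (normalizedL m.succPNat))
      (gaussianReal 0 1) := by
  intro u
  have z2 := one_le_zetaReal (le_refl 2)
  have z3 := one_le_zetaReal (show 2 ≤ 3 by norm_num)
  set c := 2 * zetaReal 3 / (3 * zetaReal 2 ^ 3) with hc
  have hc0 : 0 < c := by positivity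
  have hsc : 0 < √c := Real.sqrt_pos.mpr hc0
  set v := u / √c with hv
  set l : ℕ → ℝ := fun m => Real.log ((m : ℝ) + 1) with hl
  set w : ℕ → ℝ := fun m => v / (l m * √(l m)) with hw
  set w' : ℕ → ℝ := fun m => -Real.log (1 - w m) with hw'
  have e : ∀ m : ℕ, 0 < l m → ∀ s, Real.exp (w' m * √(c * l m ^ 3) * normalizedL m.succPNat s) =
      Real.exp (-(w' m * (l m ^ 2 / (2 * zetaReal 2)))) *
        Real.exp (0 * D (m + 1) s + w' m * L (m + 1) s) := by
    intro m hm s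
    rw [← Real.exp_add, normalizedL]
    congr 1
    have h1 : √(c * l m ^ 3) ≠ 0 := (Real.sqrt_pos.mpr (mul_pos hc0 (pow_pos hm 3))).ne'
    have h2 : ((m.succPNat : ℕ) : ℝ) = (m : ℝ) + 1 := by simp
    rw [h2]
    change w' m * √(c * l m ^ 3) *
      (((L (m + 1) s : ℝ) - l m ^ 2 / (2 * zetaReal 2)) / √(c * l m ^ 3)) = _
    field_simp
    ring
  have hev : ∀ᶠ m : ℕ in atTop, 1 ≤ l m := tendsto_log_succ.eventually_ge_atTop 1
  have hd0 : Tendsto (fun m => |v| / √(l m)) atTop (𝓝 0) := tendsto_div_sqrt_log |v|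
  refine ⟨fun m => w' m * √(c * l m ^ 3), ?_, ?_, ?_⟩
  · refine tendsto_of_abs_sub_le (b := fun m => 2 * |v| * √c * (|v| / √(l m)))
      (by simpa using hd0.const_mul (2 * |v| * √c)) ?_
    filter_upwards [hev, hd0.eventually (ge_mem_nhds (show (0 : ℝ) < 1 / 2 by norm_num))]
      with m hm hm2
    have hl0 : 0 < l m := by linarith
    have h3 : 0 < √(l m) := Real.sqrt_pos.mpr hl0
    obtain ⟨-, s2, -, -⟩ := edge_scale (v := v) hm
    have hsq : √(c * l m ^ 3) = √c * (l m * √(l m)) := by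
      rw [Real.sqrt_mul hc0.le, show l m ^ 3 = l m ^ 2 * l m by ring,
        Real.sqrt_mul (sq_nonneg _), Real.sqrt_sq hl0.le]
    have hwl : w m * (l m * √(l m)) = v := by
      simp only [hw]; field_simp
    have hu : u = w m * √(c * l m ^ 3) := by
      rw [hsq, mul_left_comm, hwl, hv]; field_simp
    have hwd : |w m| ≤ |v| / √(l m) := s2
    have hlog := abs_neg_log_one_sub_sub_le (w := w m) (hwd.trans hm2)
    calc |w' m * √(c * l m ^ 3) - u| = |w' m - w m| * √(c * l m ^ 3) := by
          rw [hu, ← sub_mul, abs_mul, abs_of_nonneg (Real.sqrt_nonneg _)]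
      _ ≤ 2 * w m ^ 2 * √(c * l m ^ 3) := by gcongr
      _ = 2 * |w m * (l m * √(l m))| * √c * |w m| := by
          rw [hsq, abs_mul, abs_of_pos (by positivity : 0 < l m * √(l m)), ← sq_abs (w m)]
          ring
      _ = 2 * |v| * √c * |w m| := by rw [hwl]
      _ ≤ _ := by gcongr
  · filter_upwards [hev] with m hm
    rw [integrable_map_measure (by fun_prop) (measurable_normalizedL _).aemeasurable]
    refine Integrable.congr ?_ (ae_of_all _ fun s => (e m (by linarith) s).symm)
    exact (integrable_exp_D_L zero_lt_one (w' m) m).1.const_mul _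
  · have hlim := tendsto_exp_mul_expMoment_edge v
    have hu2 : zetaReal 3 / (3 * zetaReal 2 ^ 3) * v ^ 2 = u ^ 2 / 2 := by
      rw [hv, div_pow, Real.sq_sqrt hc0.le, hc]
      field_simp
    rw [hu2, ← integral_exp_mul_gaussianReal] at hlim
    refine hlim.congr' ?_
    filter_upwards [hev] with m hm
    rw [integral_map (measurable_normalizedL _).aemeasurable (by fun_prop)]
    rw [integral_congr_ae (ae_of_all _ (e m (by linarith))), integral_const_mul]
    congr 1
    exact (integrable_exp_D_L zero_lt_one (w' m) m).2.symm

end BetaSplit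

theorem theorem1p7 :
    (TendstoInDistribution (fun n : ℕ+ => BetaSplit.normalizedD n) atTop (id : ℝ → ℝ)
        (fun n : ℕ+ => BetaSplit.sampleMeasure n) (gaussianReal 0 1) ∧
      ∀ k : ℕ,
        (∀ n : ℕ+, Integrable (fun s => BetaSplit.normalizedD n s ^ k)
          (BetaSplit.sampleMeasure n)) ∧
        Tendsto (fun n : ℕ+ => ∫ s, BetaSplit.normalizedD n s ^ k ∂(BetaSplit.sampleMeasure n))
          atTop (𝓝 (∫ x, x ^ k ∂(gaussianReal 0 1)))) ∧
    (TendstoInDistribution (fun n : ℕ+ => BetaSplit.normalizedL n) atTop (id : ℝ → ℝ)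
        (fun n : ℕ+ => BetaSplit.sampleMeasure n) (gaussianReal 0 1) ∧
      ∀ k : ℕ,
        (∀ n : ℕ+, Integrable (fun s => BetaSplit.normalizedL n s ^ k)
          (BetaSplit.sampleMeasure n)) ∧
        Tendsto (fun n : ℕ+ => ∫ s, BetaSplit.normalizedL n s ^ k ∂(BetaSplit.sampleMeasure n))
          atTop (𝓝 (∫ x, x ^ k ∂(gaussianReal 0 1)))) := by
  obtain ⟨d1, d2⟩ := BetaSplit.normal_limit_of_tendstoLaplace
    (fun n : ℕ+ => BetaSplit.normalizedD n) (fun n => BetaSplit.measurable_normalizedD n)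
    BetaSplit.tendstoLaplace_normalizedD
  obtain ⟨l1, l2⟩ := BetaSplit.normal_limit_of_tendstoLaplace
    (fun n : ℕ+ => BetaSplit.normalizedL n) (fun n => BetaSplit.measurable_normalizedL n)
    BetaSplit.tendstoLaplace_normalizedL
  refine ⟨⟨d1, fun k => ⟨fun n => ?_, d2 k⟩⟩, ⟨l1, fun k => ⟨fun n => ?_, l2 k⟩⟩⟩
  · exact BetaSplit.integrable_affine_pow
      (fun z hz => BetaSplit.integrable_exp_D (by linarith [le_abs_self z]) n) _ _ k
  · exact BetaSplit.integrable_affine_pow (fun z _ => BetaSplit.integrable_exp_L z n) _ _ k
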